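/- Let $1\le k\le n$, and for a partition $\lambda$ of $m$ let $\chi^\lambda$ and $\dim\lambda$ be the character and the dimension of the irreducible complex representation of $S_m$ parametrized by $\lambda$ (the Specht module). Let $\pi_m(\lambda)=(\dim\lambda)^2/m!$ be the Plancherel measure on partitions of $m$; write $\pi=\pi_n$, and equip the real functions on partitions of $n$ with the $\ell^2(\pi)$ inner product $\langle f,g\rangle_\pi=\sum_\lambda f(\lambda)g(\lambda)\pi(\lambda)$. Write $\tau\nearrow\Lambda$ if the partition $\Lambda$ is obtained from $\tau$ by adding one box. A step down moves from a partition $\Lambda$ of $m+1$ to each partition $\tau$ of $m$ with $\tau\nearrow\Lambda$ with probability $\frac{\dim\tau}{\dim\Lambda}$; a step up moves from a partition $\tau$ of $m$ to each $\Lambda$ with $\tau\nearrow\Lambda$ with probability $\frac{\dim(\tau)\,\pi_{m+1}(\Lambda)}{\dim(\Lambda)\,\pi_m(\tau)}$. Let $J(k)$ be the Markov chain on partitions of $n$ that takes $k$ steps down and then $k$ steps up, acting on functions by $(J(k)f)(\lambda)=\sum_\mu J(k)(\lambda,\mu)f(\mu)$. For each conjugacy class $C$ of $S_n$, the function $$\psi_C(\lambda)=|C|^{1/2}\,\frac{\chi^\lambda(C)}{\dim\lambda}$$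 is real valued. The functions $\psi_C$, indexed by the conjugacy classes $C$ of $S_n$, form an orthonormal basis of $\ell^2(\pi)$ consisting of eigenfunctions of $J(k)$: $$J(k)\,\psi_C=\frac{n_1(C)(n_1(C)-1)\cdots(n_1(C)-k+1)}{n(n-1)\cdots(n-k+1)}\,\psi_C ,$$ where $n_1(C)$ is the number of fixed points of any permutation in $C$. -/

import Mathlib

namespace YoungLattice

open Equiv

/-! ### Partitions of `n` as Young diagrams with `n` boxes -/

/-- Level `n` of the Young lattice: the partitions of `n`. -/
abbrev Level (n : ℕ) : Type := {lam : YoungDiagram // lam.card = n}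

theorem fst_lt_card (mu : YoungDiagram) {c : ℕ × ℕ} (hc : c ∈ mu.cells) : c.1 < mu.card := by
  have h : (Finset.range (c.1 + 1)).image (fun i => (i, c.2)) ⊆ mu.cells := by
    intro x hx
    obtain ⟨i, hi, rfl⟩ := Finset.mem_image.1 hx
    exact mu.up_left_mem (Nat.lt_succ_iff.1 (Finset.mem_range.1 hi)) le_rfl hc
  have h2 := Finset.card_le_card h
  rw [Finset.card_image_of_injective _ (fun a b hab => (Prod.mk.inj hab).1),
    Finset.card_range] at h2
  exact h2

theorem snd_lt_card (mu : YoungDiagram) {c : ℕ × ℕ} (hc : c ∈ mu.cells) : c.2 < mu.card := by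
  have h : (Finset.range (c.2 + 1)).image (fun j => (c.1, j)) ⊆ mu.cells := by
    intro x hx
    obtain ⟨j, hj, rfl⟩ := Finset.mem_image.1 hx
    exact mu.up_left_mem le_rfl (Nat.lt_succ_iff.1 (Finset.mem_range.1 hj)) hc
  have h2 := Finset.card_le_card h
  rw [Finset.card_image_of_injective _ (fun a b hab => (Prod.mk.inj hab).2),
    Finset.card_range] at h2
  exact h2

instance finiteLevel (n : ℕ) : Finite (Level n) := by
  refine Finite.of_injective (β := {s // s ∈ (Finset.range n ×ˢ Finset.range n).powerset})
    (fun lam => ⟨lam.1.cells, ?_⟩) ?_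
  · rw [Finset.mem_powerset]
    intro c hc
    have h1 := fst_lt_card lam.1 hc
    have h2 := snd_lt_card lam.1 hc
    rw [lam.2] at h1 h2
    exact Finset.mem_product.2 ⟨Finset.mem_range.2 h1, Finset.mem_range.2 h2⟩
  · intro a b hab
    exact Subtype.ext (YoungDiagram.ext (congrArg Subtype.val hab))

noncomputable instance fintypeLevel (n : ℕ) : Fintype (Level n) := Fintype.ofFinite _

noncomputable instance decidableEqLevel (n : ℕ) : DecidableEq (Level n) := Classical.decEq _

/-- The edge multiplicity `κ` of the Young lattice: `1` if `lam` is obtained from `tau` by adding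
a box, and `0` otherwise. -/
noncomputable def edge {n : ℕ} (tau : Level n) (lam : Level (n + 1)) : ℝ :=
  open Classical in if tau.1 ≤ lam.1 then 1 else 0

/-! ### Specht modules and irreducible characters of the symmetric group -/

/-- A (bijective) Young tableau of shape `lam`: the box in which each entry of `Fin n` stands. -/
abbrev Tableau {n : ℕ} (lam : Level n) : Type := Fin n ≃ {c // c ∈ lam.1.cells}

/-- The tabloid of a tableau (its class under row equivalence), recorded as the function
that sends each entry to the index of its row. -/
def Tableau.tabloid {n : ℕ} {lam : Level n} (t : Tableau lam) : Fin n → ℕ :=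
  fun a => (t a).1.1

/-- The action of a permutation on tableaux, replacing each entry `a` by `g a`. -/
def Tableau.perm {n : ℕ} {lam : Level n} (g : Perm (Fin n)) (t : Tableau lam) : Tableau lam :=
  g.symm.trans t

/-- The column stabilizer of a tableau. -/
def Tableau.columnStabilizer {n : ℕ} {lam : Level n} (t : Tableau lam) :
    Finset (Perm (Fin n)) :=
  Finset.univ.filter fun q => ∀ a, (t (q a)).1.2 = (t a).1.2

/-- The permutation representation of `S_n` on the complex vector space spanned by all maps
`Fin n → ℕ` (in particular, by all tabloids), with `(g • f) a = f (g⁻¹ a)`. -/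
noncomputable def tabloidRep (n : ℕ) :
    Representation ℂ (Perm (Fin n)) ((Fin n → ℕ) →₀ ℂ) where
  toFun g := Finsupp.lmapDomain ℂ ℂ (fun f : Fin n → ℕ => f ∘ g.symm)
  map_one' := by
    ext f : 2
    simp [Finsupp.mapDomain_single, Perm.one_def]
  map_mul' g h := by
    ext f : 2
    simp [Finsupp.mapDomain_single, Perm.mul_def, Function.comp_assoc]

/-- The polytabloid of a tableau: the signed sum, over the column stabilizer, of the tabloids of
the permuted tableaux. -/
noncomputable def Tableau.polytabloid {n : ℕ} {lam : Level n} (t : Tableau lam) :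
    (Fin n → ℕ) →₀ ℂ :=
  ∑ q ∈ t.columnStabilizer, Finsupp.single (t.perm q).tabloid (((Perm.sign q : ℤˣ) : ℤ) : ℂ)

theorem tabloidRep_polytabloid {n : ℕ} {lam : Level n} (g : Perm (Fin n)) (t : Tableau lam) :
    tabloidRep n g t.polytabloid = (t.perm g).polytabloid := by
  unfold Tableau.polytabloid
  rw [map_sum]
  refine Finset.sum_bij' (fun q _ => g * q * g⁻¹) (fun q _ => g⁻¹ * q * g) ?_ ?_ ?_ ?_ ?_
  · intro q hq
    have hq' := (Finset.mem_filter.1 hq).2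
    refine Finset.mem_filter.2 ⟨Finset.mem_univ _, fun a => ?_⟩
    simpa [Tableau.perm] using hq' (g.symm a)
  · intro q hq
    have hq' := (Finset.mem_filter.1 hq).2
    refine Finset.mem_filter.2 ⟨Finset.mem_univ _, fun a => ?_⟩
    simpa [Tableau.perm] using hq' (g a)
  · intro q _; group
  · intro q _; group
  · intro q _
    have h1 : Perm.sign (g * q * g⁻¹) = Perm.sign q := by
      rw [map_mul, map_mul, map_inv, mul_comm, inv_mul_cancel_left]
    rw [h1]
    change Finsupp.mapDomain _ _ = _
    rw [Finsupp.mapDomain_single]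
    congr 1
    funext a
    change (t (q.symm (g.symm a))).1.1 = (t (g.symm ((g * q * g⁻¹).symm a))).1.1
    have h2 : (g * q * g⁻¹).symm a = g (q.symm (g.symm a)) := by
      rw [Equiv.symm_apply_eq]
      simp
    rw [h2, Equiv.symm_apply_apply]

/-- The Specht module `S^lam`: the span of the polytabloids of shape `lam`. It is the irreducible
complex representation of `S_n` parametrized by `lam`. -/
noncomputable def specht {n : ℕ} (lam : Level n) : Subrepresentation (tabloidRep n) where
  toSubmodule := Submodule.span ℂ (Set.range fun t : Tableau lam => t.polytabloid)
  apply_mem_toSubmodule g v hv := by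
    induction hv using Submodule.span_induction with
    | mem x hx =>
      obtain ⟨t, rfl⟩ := hx
      simp only [tabloidRep_polytabloid]
      exact Submodule.subset_span ⟨t.perm g, rfl⟩
    | zero => simp
    | add x y _ _ hx hy => rw [map_add]; exact Submodule.add_mem _ hx hy
    | smul a x _ hx => rw [map_smul]; exact Submodule.smul_mem _ a hx

/-- `χ^lam`, the irreducible character of `S_n` parametrized by `lam`. -/
noncomputable def chi {n : ℕ} (lam : Level n) (g : Perm (Fin n)) : ℂ :=
  LinearMap.trace ℂ (specht lam).toSubmodule ((specht lam).toRepresentation g)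

/-- `dim lam`, the dimension of the irreducible representation parametrized by `lam`. -/
noncomputable def dim {n : ℕ} (lam : Level n) : ℕ :=
  Module.finrank ℂ (specht lam).toSubmodule

/-! ### Plancherel measure and the chains `J(k)` -/

/-- The Plancherel measure on the partitions of `n`. -/
noncomputable def plancherel {n : ℕ} (lam : Level n) : ℝ :=
  (dim lam : ℝ) ^ 2 / (n.factorial : ℝ)

/-- The inner product of `ℓ²(π)`, where `π` is the Plancherel measure on the partitions of `n`. -/
noncomputable def plancherelInner {n : ℕ} (f g : Level n → ℝ) : ℝ :=
  ∑ lam, f lam * g lam * plancherel lam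

/-- Transition probabilities of one step down in the Young lattice:
`dim tau * κ(tau, lam) / dim lam`. -/
noncomputable def downStep (n : ℕ) : Matrix (Level (n + 1)) (Level n) ℝ :=
  Matrix.of fun lam tau => (dim tau : ℝ) * edge tau lam / (dim lam : ℝ)

/-- Transition probabilities of one step up in the Young lattice:
`dim tau * M_{n+1}(lam) * κ(tau, lam) / (dim lam * M_n(tau))`, with `M` the Plancherel measure. -/
noncomputable def upStep (n : ℕ) : Matrix (Level n) (Level (n + 1)) ℝ :=
  Matrix.of fun tau lam =>
    (dim tau : ℝ) * plancherel lam * edge tau lam / ((dim lam : ℝ) * plancherel tau)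

/-- The transition matrix of the chain `J(k)` on the partitions of `n`, for `k ≤ n`: `k` single
steps down followed by `k` single steps up. For `k + 1` steps from level `n + 1`, this is one step
down to level `n`, then `k` steps down and `k` steps up from there, then one step up to
level `n + 1`. (The value for `k > n` is a placeholder.) -/
noncomputable def chainJ : (n k : ℕ) → Matrix (Level n) (Level n) ℝ
  | _, 0 => 1
  | 0, _ + 1 => 0
  | n + 1, k + 1 => downStep n * chainJ n k * upStep n

/-- The number of fixed points of a permutation. -/
def numFixed {n : ℕ} (g : Perm (Fin n)) : ℕ := (Finset.univ.filter fun i => g i = i).card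

end YoungLattice

namespace YoungLattice

open Equiv

/-! ### Column antisymmetrizers -/

/-! Orthonormality of the `ψ_C` is column orthogonality of the character table: the Plancherel
weight `(dim lam)² / n!` cancels the two denominators `dim lam`. The eigenvalue equation holds
because, on normalized characters, a step down restricts a representation from `S_{n+1}` to `S_n`
and a step up induces it back. Thus `downStep` sends `χ(g)/dim` to `χ(g)/dim` for the embedded `g`,
while `upStep` undoes this up to the factor `n₁/(n+1)` and kills the classes without fixed points.
Iterating gives the quotient of falling factorials (`chainJ_mulVec_normChi`).

Two facts about Specht modules are needed. The first is column orthogonality. James' argument with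
signed column sums gives `Hom(S^lam, S^mu)` dimension 1 or 0, hence row orthogonality
(`sum_chi_mul_chi_inv`). There are as many Young diagrams as conjugacy classes, so the normalized
table is square and its rows being orthonormal makes its columns orthonormal.

The second is the branching rule `mult_eq_edge`. Deleting the last entry of a tabloid shows that
`S^tau` occurs in the restriction of `S^lam` whenever `tau ↗ lam` (`edge_le_mult`). Nothing else
occurs, by counting dimensions: the local inequality `sum_edge_below_add_le_above` of the Young
lattice (half of `DU - UD = 1`) forces the branching sums to have total square at least `(n+1)!`,
which is already the sum of all `(dim lam)²`. -/

theorem tabloidRep_single {n : ℕ} (g : Perm (Fin n)) (f : Fin n → ℕ) (c : ℂ) :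
    tabloidRep n g (Finsupp.single f c) = Finsupp.single (f ∘ g.symm) c :=
  Finsupp.mapDomain_single

namespace Tableau

variable {n : ℕ} {lam mu : Level n}

theorem mem_columnStabilizer {t : Tableau lam} {q : Perm (Fin n)} :
    q ∈ t.columnStabilizer ↔ ∀ a, (t (q a)).1.2 = (t a).1.2 := by
  simp [columnStabilizer]

theorem one_mem_columnStabilizer (t : Tableau lam) : 1 ∈ t.columnStabilizer :=
  mem_columnStabilizer.2 fun _ => rfl

theorem mul_mem_columnStabilizer {t : Tableau lam} {p q : Perm (Fin n)}
    (hp : p ∈ t.columnStabilizer) (hq : q ∈ t.columnStabilizer) :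
    p * q ∈ t.columnStabilizer :=
  mem_columnStabilizer.2 fun a =>
    (mem_columnStabilizer.1 hp (q a)).trans (mem_columnStabilizer.1 hq a)

theorem inv_mem_columnStabilizer {t : Tableau lam} {q : Perm (Fin n)}
    (hq : q ∈ t.columnStabilizer) : q⁻¹ ∈ t.columnStabilizer :=
  mem_columnStabilizer.2 fun a => by
    have := mem_columnStabilizer.1 hq (q⁻¹ a)
    simpa using this.symm

/-- The signed column sum of a tableau, acting on the span of all maps `Fin n → ℕ`. -/
noncomputable def colSym (t : Tableau lam) :
    ((Fin n → ℕ) →₀ ℂ) →ₗ[ℂ] ((Fin n → ℕ) →₀ ℂ) :=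
  ∑ q ∈ t.columnStabilizer, (((Perm.sign q : ℤˣ) : ℤ) : ℂ) • tabloidRep n q

theorem colSym_apply (t : Tableau lam) (v : (Fin n → ℕ) →₀ ℂ) :
    t.colSym v = ∑ q ∈ t.columnStabilizer, (((Perm.sign q : ℤˣ) : ℤ) : ℂ) • tabloidRep n q v := by
  simp [colSym]

theorem colSym_single_tabloid (t : Tableau lam) :
    t.colSym (Finsupp.single t.tabloid 1) = t.polytabloid := by
  rw [colSym_apply, polytabloid]
  refine Finset.sum_congr rfl fun q _ => ?_
  rw [tabloidRep_single, Finsupp.smul_single, smul_eq_mul, mul_one]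
  rfl

theorem sign_mul_self (q : Perm (Fin n)) :
    (((Perm.sign q : ℤˣ) : ℤ) : ℂ) * (((Perm.sign q : ℤˣ) : ℤ) : ℂ) = 1 := by
  rw [← Int.cast_mul, ← Units.val_mul, Int.units_mul_self]
  simp

theorem colSym_tabloidRep (t : Tableau lam) {p : Perm (Fin n)} (hp : p ∈ t.columnStabilizer)
    (v : (Fin n → ℕ) →₀ ℂ) :
    t.colSym (tabloidRep n p v) = (((Perm.sign p : ℤˣ) : ℤ) : ℂ) • t.colSym v := by
  rw [colSym_apply, colSym_apply, Finset.smul_sum]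
  refine Finset.sum_bij' (fun q _ => q * p) (fun q _ => q * p⁻¹)
    (fun q hq => mul_mem_columnStabilizer hq hp)
    (fun q hq => mul_mem_columnStabilizer hq (inv_mem_columnStabilizer hp))
    (fun q _ => by group) (fun q _ => by group) fun q _ => ?_
  rw [map_mul, smul_smul, map_mul, Units.val_mul, Int.cast_mul, Module.End.mul_apply,
    mul_comm (((Perm.sign q : ℤˣ) : ℤ) : ℂ), ← mul_assoc, sign_mul_self, one_mul]

theorem tabloidRep_colSym (t : Tableau lam) {p : Perm (Fin n)} (hp : p ∈ t.columnStabilizer)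
    (v : (Fin n → ℕ) →₀ ℂ) :
    tabloidRep n p (t.colSym v) = (((Perm.sign p : ℤˣ) : ℤ) : ℂ) • t.colSym v := by
  rw [colSym_apply, map_sum, Finset.smul_sum]
  refine Finset.sum_bij' (fun q _ => p * q) (fun q _ => p⁻¹ * q)
    (fun q hq => mul_mem_columnStabilizer hp hq)
    (fun q hq => mul_mem_columnStabilizer (inv_mem_columnStabilizer hp) hq)
    (fun q _ => by group) (fun q _ => by group) fun q _ => ?_
  rw [map_mul, smul_smul, map_mul, Units.val_mul, Int.cast_mul, Module.End.mul_apply,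
    ← mul_assoc, sign_mul_self, one_mul, map_smul]

theorem colSym_polytabloid (t : Tableau lam) :
    t.colSym t.polytabloid = (t.columnStabilizer.card : ℂ) • t.polytabloid := by
  rw [← colSym_single_tabloid t, colSym_apply]
  rw [Finset.sum_congr rfl fun q hq => by
    rw [tabloidRep_colSym t hq, smul_smul, sign_mul_self, one_smul]]
  rw [Finset.sum_const, Nat.cast_smul_eq_nsmul]

theorem card_columnStabilizer_ne_zero (t : Tableau lam) :
    (t.columnStabilizer.card : ℂ) ≠ 0 :=
  Nat.cast_ne_zero.2 (Finset.card_ne_zero_of_mem t.one_mem_columnStabilizer)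

/-- The entries of each column of `t` have different images under `f`. -/
def ColInj (t : Tableau lam) (f : Fin n → ℕ) : Prop :=
  ∀ a b, (t a).1.2 = (t b).1.2 → f a = f b → a = b

/-- Two entries of one column with equal image are exchanged by a transposition that fixes `f` but
has sign -1, so the signed sum equals its own negative. -/
theorem colSym_single_eq_zero (t : Tableau lam) {f : Fin n → ℕ} (hf : ¬ t.ColInj f) :
    t.colSym (Finsupp.single f 1) = 0 := by
  simp only [ColInj, not_forall] at hf
  obtain ⟨a, b, hcol, hab, hne⟩ := hf
  have hmem : swap a b ∈ t.columnStabilizer := by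
    refine mem_columnStabilizer.2 fun c => ?_
    by_cases h1 : c = a
    · subst h1; rw [swap_apply_left, hcol]
    by_cases h2 : c = b
    · subst h2; rw [swap_apply_right, hcol]
    rw [swap_apply_of_ne_of_ne h1 h2]
  have h := colSym_tabloidRep t hmem (Finsupp.single f 1)
  have hfix : f ∘ (swap a b).symm = f := by
    funext c
    rw [symm_swap, Function.comp_apply]
    by_cases h1 : c = a
    · subst h1; rw [swap_apply_left, hab]
    by_cases h2 : c = b
    · subst h2; rw [swap_apply_right, hab]
    rw [swap_apply_of_ne_of_ne h1 h2]
  rw [tabloidRep_single, hfix, Perm.sign_swap hne] at h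
  simp only [Units.val_neg, Units.val_one, Int.cast_neg, Int.cast_one, neg_smul, one_smul] at h
  exact self_eq_neg.1 h

/-! ### Dominance -/

/-- Columns are top-justified, so the tabloid of `t` itself attains the bound that
`ColInj.card_filter_le` gives for every `f` injective on columns. -/
theorem card_filter_col_and_lt (t : Tableau lam) (j r : ℕ) :
    (Finset.univ.filter fun a => (t a).1.2 = j ∧ (t a).1.1 < r).card =
      min (lam.1.colLen j) r := by
  rw [← Finset.card_range (min (lam.1.colLen j) r)]
  refine Finset.card_bij (fun a _ => (t a).1.1) ?_ ?_ ?_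
  · intro a ha
    obtain ⟨-, h1, h2⟩ := Finset.mem_filter.1 ha
    refine Finset.mem_range.2 (lt_min ?_ h2)
    rw [← YoungDiagram.mem_iff_lt_colLen, ← h1]
    exact (t a).2
  · intro a ha b hb hab
    obtain ⟨-, h1, -⟩ := Finset.mem_filter.1 ha
    obtain ⟨-, h2, -⟩ := Finset.mem_filter.1 hb
    exact t.injective (Subtype.ext (Prod.ext hab (h1.trans h2.symm)))
  · intro i hi
    have hi' := lt_min_iff.1 (Finset.mem_range.1 hi)
    have hm : (i, j) ∈ lam.1.cells := YoungDiagram.mem_iff_lt_colLen.2 hi'.1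
    refine ⟨t.symm ⟨(i, j), hm⟩, Finset.mem_filter.2 ⟨Finset.mem_univ _, ?_, ?_⟩, ?_⟩ <;>
      simp [hi'.2]

theorem card_filter_col (t : Tableau lam) (j : ℕ) :
    (Finset.univ.filter fun a => (t a).1.2 = j).card = lam.1.colLen j := by
  have h := t.card_filter_col_and_lt j (lam.1.colLen j)
  rw [min_self] at h
  rw [← h]
  congr 1
  refine Finset.filter_congr fun a _ => ?_
  refine ⟨fun ha => ⟨ha, ?_⟩, And.left⟩
  rw [← YoungDiagram.mem_iff_lt_colLen, ← ha]
  exact (t a).2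

theorem ColInj.card_filter_le {t : Tableau lam} {f : Fin n → ℕ} (hf : t.ColInj f) (j r : ℕ) :
    (Finset.univ.filter fun a => (t a).1.2 = j ∧ f a < r).card ≤ min (lam.1.colLen j) r := by
  refine le_min ?_ ?_
  · rw [← t.card_filter_col j]
    exact Finset.card_le_card fun a ha => by
      simp only [Finset.mem_filter] at ha ⊢
      exact ⟨ha.1, ha.2.1⟩
  · conv_rhs => rw [← Finset.card_range r]
    refine Finset.card_le_card_of_injOn f ?_ ?_
    · intro a ha
      exact Finset.mem_coe.2 (Finset.mem_range.2 (Finset.mem_filter.1 ha).2.2)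
    · intro a ha b hb hab
      exact hf a b ((Finset.mem_filter.1 ha).2.1.trans (Finset.mem_filter.1 hb).2.1.symm) hab

theorem card_filter_eq_sum_col (t : Tableau lam) (f : Fin n → ℕ) (r : ℕ) :
    (Finset.univ.filter fun a => f a < r).card =
      ∑ j ∈ Finset.univ.image (fun a => (t a).1.2),
        (Finset.univ.filter fun a => (t a).1.2 = j ∧ f a < r).card := by
  rw [Finset.card_eq_sum_card_fiberwise (f := fun a => (t a).1.2)
    (t := Finset.univ.image (fun a => (t a).1.2))
    (fun a _ => Finset.mem_coe.2 (Finset.mem_image_of_mem _ (Finset.mem_univ a)))]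
  refine Finset.sum_congr rfl fun j _ => ?_
  rw [Finset.filter_filter]
  congr 1
  exact Finset.filter_congr fun a _ => and_comm

theorem ColInj.dominance {t : Tableau lam} {f : Fin n → ℕ} (hf : t.ColInj f) (r : ℕ) :
    (Finset.univ.filter fun a => f a < r).card ≤
      (Finset.univ.filter fun a => t.tabloid a < r).card := by
  rw [t.card_filter_eq_sum_col f, t.card_filter_eq_sum_col t.tabloid]
  refine Finset.sum_le_sum fun j _ => ?_
  exact (hf.card_filter_le j r).trans_eq (t.card_filter_col_and_lt j r).symm

theorem card_filter_tabloid (t : Tableau lam) (r : ℕ) :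
    (Finset.univ.filter fun a => t.tabloid a < r).card =
      (lam.1.cells.filter fun c => c.1 < r).card := by
  refine Finset.card_bij (fun a _ => (t a).1) ?_ ?_ ?_
  · intro a ha
    exact Finset.mem_filter.2 ⟨(t a).2, (Finset.mem_filter.1 ha).2⟩
  · intro a _ b _ hab
    exact t.injective (Subtype.ext hab)
  · intro c hc
    obtain ⟨h1, h2⟩ := Finset.mem_filter.1 hc
    exact ⟨t.symm ⟨c, h1⟩, Finset.mem_filter.2
      ⟨Finset.mem_univ _, by simpa [tabloid] using h2⟩, by simp⟩

/-- This is the equality case of dominance: for equal shapes every columnwise bound is attained, so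
rows taken from `s` and columns taken from `t` together fill the diagram. -/
theorem ColInj.exists_perm {t s : Tableau lam} (hf : t.ColInj s.tabloid) :
    ∃ q ∈ t.columnStabilizer, s.tabloid = (t.perm q).tabloid := by
  have hsum : ∀ r, ∀ j ∈ Finset.univ.image (fun a => (t a).1.2),
      (Finset.univ.filter fun a => (t a).1.2 = j ∧ s.tabloid a < r).card =
        (Finset.univ.filter fun a => (t a).1.2 = j ∧ t.tabloid a < r).card := by
    intro r
    refine (Finset.sum_eq_sum_iff_of_le fun j _ => ?_).1 ?_
    · exact (hf.card_filter_le j r).trans_eq (t.card_filter_col_and_lt j r).symm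
    · rw [← t.card_filter_eq_sum_col, ← t.card_filter_eq_sum_col, card_filter_tabloid,
        card_filter_tabloid]
  have hmem : ∀ a, (s.tabloid a, (t a).1.2) ∈ lam.1.cells := by
    intro a
    -- With `r` the length of the column, the count for `t` is the whole column; hence every entry
    -- of that column has its `s`-row below the column length.
    have h := hsum (lam.1.colLen (t a).1.2) _ (Finset.mem_image_of_mem _ (Finset.mem_univ a))
    rw [show (Finset.univ.filter fun b => (t b).1.2 = (t a).1.2 ∧
      t.tabloid b < lam.1.colLen (t a).1.2).card = lam.1.colLen (t a).1.2 from
        (t.card_filter_col_and_lt _ _).trans (min_self _), ← t.card_filter_col] at h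
    have h2 := Finset.eq_of_subset_of_card_le (fun b hb => by
      simp only [Finset.mem_filter] at hb ⊢
      exact ⟨hb.1, hb.2.1⟩) h.ge
    have h3 := (Finset.ext_iff.1 h2 a).2 (by simp)
    have h4 := (Finset.mem_filter.1 h3).2.2
    rw [t.card_filter_col] at h4
    exact YoungDiagram.mem_iff_lt_colLen.2 h4
  let u : Fin n → {c // c ∈ lam.1.cells} := fun a => ⟨(s.tabloid a, (t a).1.2), hmem a⟩
  have hinj : Function.Injective u := by
    intro a b hab
    have h : (s.tabloid a, (t a).1.2) = (s.tabloid b, (t b).1.2) := congrArg Subtype.val hab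
    exact hf a b (Prod.mk.inj h).2 (Prod.mk.inj h).1
  have hbij : Function.Bijective u := by
    rw [Fintype.bijective_iff_injective_and_card]
    exact ⟨hinj, Fintype.card_congr t⟩
  let e : Tableau lam := Equiv.ofBijective u hbij
  -- This permutation is chosen so that `t.perm q` is `e`.
  refine ⟨t.trans e.symm, mem_columnStabilizer.2 fun a => ?_, ?_⟩
  · have h : e (e.symm (t a)) = t a := e.apply_symm_apply _
    have h2 : (e (e.symm (t a))).1.2 = (t (e.symm (t a))).1.2 := rfl
    rw [h] at h2
    exact h2.symm
  · funext a
    change s.tabloid a = (t (t.symm (e a))).1.1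
    rw [Equiv.apply_symm_apply]
    rfl

theorem exists_colSym_single_tabloid (t s : Tableau lam) :
    ∃ c : ℂ, t.colSym (Finsupp.single s.tabloid 1) = c • t.polytabloid := by
  by_cases h : t.ColInj s.tabloid
  · obtain ⟨q, hq, hs⟩ := h.exists_perm
    refine ⟨(((Perm.sign q : ℤˣ) : ℤ) : ℂ), ?_⟩
    have : Finsupp.single s.tabloid (1 : ℂ) = tabloidRep n q (Finsupp.single t.tabloid 1) := by
      rw [tabloidRep_single, hs]
      rfl
    rw [this, colSym_tabloidRep t hq, colSym_single_tabloid]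
  · exact ⟨0, by rw [colSym_single_eq_zero t h, zero_smul]⟩

end Tableau

/-- The span of the tabloids of shape `lam`. -/
noncomputable def tabloidSpan {n : ℕ} (lam : Level n) : Submodule ℂ ((Fin n → ℕ) →₀ ℂ) :=
  Submodule.span ℂ (Set.range fun t : Tableau lam => Finsupp.single t.tabloid 1)

theorem specht_le_tabloidSpan {n : ℕ} (lam : Level n) :
    (specht lam).toSubmodule ≤ tabloidSpan lam := by
  refine Submodule.span_le.2 ?_
  rintro _ ⟨t, rfl⟩
  refine Submodule.sum_mem _ fun q _ => ?_
  rw [← mul_one (((Perm.sign q : ℤˣ) : ℤ) : ℂ), ← smul_eq_mul, ← Finsupp.smul_single]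
  exact Submodule.smul_mem _ _ (Submodule.subset_span ⟨t.perm q, rfl⟩)

theorem exists_colSym_eq_smul {n : ℕ} {lam : Level n} (t : Tableau lam)
    {v : (Fin n → ℕ) →₀ ℂ} (hv : v ∈ tabloidSpan lam) :
    ∃ c : ℂ, t.colSym v = c • t.polytabloid := by
  suffices h : tabloidSpan lam ≤ (Submodule.span ℂ {t.polytabloid}).comap t.colSym by
    obtain ⟨c, hc⟩ := Submodule.mem_span_singleton.1 (h hv)
    exact ⟨c, hc.symm⟩
  refine Submodule.span_le.2 ?_
  rintro _ ⟨s, rfl⟩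
  obtain ⟨c, hc⟩ := t.exists_colSym_single_tabloid s
  exact Submodule.mem_span_singleton.2 ⟨c, hc.symm⟩

theorem dominance_of_colSym_ne_zero {n : ℕ} {lam mu : Level n} (t : Tableau lam)
    {v : (Fin n → ℕ) →₀ ℂ} (hv : v ∈ tabloidSpan mu) (h : t.colSym v ≠ 0) (r : ℕ) :
    (mu.1.cells.filter fun c => c.1 < r).card ≤ (lam.1.cells.filter fun c => c.1 < r).card := by
  by_contra hlt
  refine h ?_
  suffices h : tabloidSpan mu ≤ LinearMap.ker t.colSym from h hv
  refine Submodule.span_le.2 ?_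
  rintro _ ⟨s, rfl⟩
  refine t.colSym_single_eq_zero fun hs => hlt ?_
  rw [← s.card_filter_tabloid, ← t.card_filter_tabloid]
  exact hs.dominance r

/-- Successive differences of the counts are the row lengths. -/
theorem level_ext_of_card_filter {n : ℕ} {lam mu : Level n}
    (h : ∀ r, (mu.1.cells.filter fun c => c.1 < r).card =
      (lam.1.cells.filter fun c => c.1 < r).card) : lam = mu := by
  have key : ∀ (nu : Level n) (r : ℕ), (nu.1.cells.filter fun c => c.1 < r + 1).card =
      (nu.1.cells.filter fun c => c.1 < r).card + nu.1.rowLen r := by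
    intro nu r
    rw [YoungDiagram.rowLen_eq_card, YoungDiagram.row, ← Finset.card_union_of_disjoint,
      ← Finset.filter_or]
    · congr 1
      exact Finset.filter_congr fun c _ => Nat.lt_succ_iff_lt_or_eq
    · refine Finset.disjoint_filter.2 fun c _ h1 h2 => ?_
      omega
  have hrow : ∀ r, lam.1.rowLen r = mu.1.rowLen r := by
    intro r
    have h1 := key lam r
    have h2 := key mu r
    rw [h, h] at h2
    omega
  refine Subtype.ext (YoungDiagram.ext ?_)
  ext ⟨i, j⟩
  rw [YoungDiagram.mem_cells, YoungDiagram.mem_cells, YoungDiagram.mem_iff_lt_rowLen,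
    YoungDiagram.mem_iff_lt_rowLen, hrow]

/-! ### Homomorphisms between Specht modules -/

instance finiteDimensional_specht {n : ℕ} (lam : Level n) :
    FiniteDimensional ℂ (specht lam).toSubmodule :=
  FiniteDimensional.span_of_finite ℂ (Set.finite_range _)

instance nonempty_tableau {n : ℕ} (lam : Level n) : Nonempty (Tableau lam) := by
  refine ⟨Fintype.equivOfCardEq ?_⟩
  rw [Fintype.card_fin, Fintype.card_coe]
  exact lam.2.symm

/-- A column permutation that also preserves every row is the identity, so the leading tabloid
appears exactly once. -/
theorem Tableau.polytabloid_apply_tabloid {n : ℕ} {lam : Level n} (t : Tableau lam) :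
    t.polytabloid t.tabloid = 1 := by
  rw [Tableau.polytabloid, Finsupp.finsetSum_apply, Finset.sum_eq_single 1]
  · have : (t.perm 1).tabloid = t.tabloid := rfl
    rw [this, Finsupp.single_eq_same]
    simp
  · intro q hq hne
    refine Finsupp.single_eq_of_ne' fun h => hne ?_
    have hinv := Tableau.mem_columnStabilizer.1 (Tableau.inv_mem_columnStabilizer hq)
    have : q⁻¹ = 1 := by
      ext1 a
      exact t.injective (Subtype.ext (Prod.ext (congrFun h a) (hinv a)))
    exact inv_eq_one.1 this
  · exact fun h => absurd t.one_mem_columnStabilizer h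

theorem Tableau.polytabloid_ne_zero {n : ℕ} {lam : Level n} (t : Tableau lam) :
    t.polytabloid ≠ 0 := by
  intro h
  have := t.polytabloid_apply_tabloid
  rw [h] at this
  simp at this

/-- The polytabloid of a tableau as an element of the Specht module. -/
noncomputable def Tableau.spechtVec {n : ℕ} {lam : Level n} (t : Tableau lam) :
    (specht lam).toSubmodule :=
  ⟨t.polytabloid, Submodule.subset_span ⟨t, rfl⟩⟩

theorem Tableau.spechtVec_ne_zero {n : ℕ} {lam : Level n} (t : Tableau lam) :
    t.spechtVec ≠ 0 :=
  fun h => t.polytabloid_ne_zero (congrArg Subtype.val h)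

theorem Tableau.toRepresentation_spechtVec {n : ℕ} {lam : Level n} (t : Tableau lam)
    (g : Perm (Fin n)) :
    (specht lam).toRepresentation g t.spechtVec = (t.perm g).spechtVec :=
  Subtype.ext (tabloidRep_polytabloid g t)

theorem span_spechtVec {n : ℕ} (lam : Level n) :
    Submodule.span ℂ (Set.range fun t : Tableau lam => t.spechtVec) = ⊤ := by
  refine Submodule.map_injective_of_injective (specht lam).toSubmodule.injective_subtype ?_
  rw [Submodule.map_span, Submodule.map_top, Submodule.range_subtype, ← Set.range_comp]
  rfl

theorem Tableau.exists_perm_eq {n : ℕ} {lam : Level n} (t s : Tableau lam) :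
    ∃ g : Perm (Fin n), s = t.perm g := by
  refine ⟨t.trans s.symm, ?_⟩
  ext1 a
  change s a = t (t.symm (s a))
  rw [Equiv.apply_symm_apply]

/-- The Specht module is cyclic, generated by any one polytabloid, since permutations act
transitively on tableaux. -/
theorem intertwiningMap_ext_spechtVec {n : ℕ} {lam : Level n} {W : Type*} [AddCommMonoid W]
    [Module ℂ W] {ρ : Representation ℂ (Perm (Fin n)) W} (t : Tableau lam)
    {f f' : Representation.IntertwiningMap (specht lam).toRepresentation ρ}
    (h : f t.spechtVec = f' t.spechtVec) : f = f' := by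
  refine Representation.IntertwiningMap.ext ?_
  refine LinearMap.ext_on_range (span_spechtVec lam) fun s => ?_
  obtain ⟨g, rfl⟩ := t.exists_perm_eq s
  rw [← t.toRepresentation_spechtVec g, Representation.IntertwiningMap.toLinearMap_apply,
    Representation.IntertwiningMap.toLinearMap_apply, f.isIntertwining, f'.isIntertwining, h]

/-- The signed column sum comes from the group algebra, so it commutes with `f`; on the polytabloid
of `t` it is multiplication by the order of the column stabilizer. -/
theorem colSym_intertwiningMap {n : ℕ} {lam mu : Level n} (t : Tableau lam)
    (f : Representation.IntertwiningMap (specht lam).toRepresentation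
      (specht mu).toRepresentation) :
    t.colSym (f t.spechtVec).1 = (t.columnStabilizer.card : ℂ) • (f t.spechtVec).1 := by
  have h : ∑ q ∈ t.columnStabilizer, (((Perm.sign q : ℤˣ) : ℤ) : ℂ) •
      (specht lam).toRepresentation q t.spechtVec =
        (t.columnStabilizer.card : ℂ) • t.spechtVec := by
    refine Subtype.ext ?_
    rw [AddSubmonoidClass.coe_finsetSum]
    exact (t.colSym_apply t.polytabloid).symm.trans t.colSym_polytabloid
  have h2 := congrArg (fun v => (f v).1) h
  simp only [map_sum, map_smul, Representation.IntertwiningMap.isIntertwining] at h2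
  rw [AddSubmonoidClass.coe_finsetSum] at h2
  rw [t.colSym_apply]
  exact h2

theorem intertwiningMap_eq_zero {n : ℕ} {lam mu : Level n}
    (f : Representation.IntertwiningMap (specht lam).toRepresentation
      (specht mu).toRepresentation) (t : Tableau lam)
    (h : ∃ r, (lam.1.cells.filter fun c => c.1 < r).card <
      (mu.1.cells.filter fun c => c.1 < r).card) : f = 0 := by
  refine intertwiningMap_ext_spechtVec (ρ := (specht mu).toRepresentation) t
    (by_contra fun h0 => ?_)
  obtain ⟨r, hr⟩ := h
  refine absurd (dominance_of_colSym_ne_zero t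
    (specht_le_tabloidSpan mu (f t.spechtVec).2) ?_ r) hr.not_ge
  rw [colSym_intertwiningMap]
  exact smul_ne_zero t.card_columnStabilizer_ne_zero fun h => h0 (Subtype.ext h)

/-- An endomorphism sends the polytabloid of `t` to an eigenvector of `t.colSym` with nonzero
eigenvalue, and the image of `t.colSym` on tabloids of this shape is the line through that
polytabloid. By cyclicity the endomorphism is a scalar. -/
theorem finrank_intertwiningMap_self {n : ℕ} (lam : Level n) :
    Module.finrank ℂ (Representation.IntertwiningMap (specht lam).toRepresentation
      (specht lam).toRepresentation) = 1 := by
  obtain ⟨t⟩ := nonempty_tableau lam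
  have hbij : Function.Bijective (LinearMap.toSpanSingleton ℂ _
      (Representation.IntertwiningMap.id (specht lam).toRepresentation)) := by
    constructor
    · intro a b hab
      have h : a • t.polytabloid = b • t.polytabloid :=
        congrArg (fun f => (f t.spechtVec).1) hab
      exact smul_left_injective ℂ t.polytabloid_ne_zero h
    · intro f
      obtain ⟨c, hc⟩ := exists_colSym_eq_smul t (specht_le_tabloidSpan lam (f t.spechtVec).2)
      rw [colSym_intertwiningMap] at hc
      refine ⟨(t.columnStabilizer.card : ℂ)⁻¹ * c, intertwiningMap_ext_spechtVec t ?_⟩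
      refine Subtype.ext ?_
      change ((t.columnStabilizer.card : ℂ)⁻¹ * c) • t.polytabloid = _
      rw [mul_smul, ← hc, inv_smul_smul₀ t.card_columnStabilizer_ne_zero]
  rw [← (LinearEquiv.ofBijective _ hbij).finrank_eq, Module.finrank_self]

/-! ### Orthogonality of characters -/

theorem sum_chi_mul_chi_inv {n : ℕ} (lam mu : Level n) :
    ∑ g, chi lam g * chi mu g⁻¹ = if lam = mu then (n.factorial : ℂ) else 0 := by
  have hcard : Nat.card (Perm (Fin n)) = n.factorial := by
    rw [Nat.card_eq_fintype_card, Fintype.card_perm, Fintype.card_fin]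
  have hne : (n.factorial : ℂ) ≠ 0 := Nat.cast_ne_zero.2 n.factorial_ne_zero
  have : Invertible (Nat.card (Perm (Fin n)) : ℂ) := invertibleOfNonzero (by rwa [hcard])
  have key := fun a b : Level n =>
    Representation.card_inv_mul_sum_char_mul_char_eq_finrank
      (G := Perm (Fin n)) (k := ℂ) (V := (specht a).toSubmodule) (W := (specht b).toSubmodule)
      (specht a).toRepresentation (specht b).toRepresentation
  simp only [hcard] at key
  -- The sum is symmetric in the two shapes, so it is enough that one of the two Hom spaces
  -- vanishes; the sign of the dominance defect decides which.
  have hswap : ∑ g, chi lam g * chi mu g⁻¹ = ∑ g, chi mu g * chi lam g⁻¹ :=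
    Fintype.sum_equiv (Equiv.inv _) _ _ fun g => by simp [mul_comm]
  have key1 : (n.factorial : ℂ)⁻¹ * ∑ g, chi lam g * chi mu g⁻¹ = _ := key mu lam
  have key2 : (n.factorial : ℂ)⁻¹ * ∑ g, chi mu g * chi lam g⁻¹ = _ := key lam mu
  split_ifs with h
  · subst h
    rw [finrank_intertwiningMap_self, Nat.cast_one] at key1
    field_simp at key1
    exact key1
  · have h0 : ∃ r, (lam.1.cells.filter fun c => c.1 < r).card ≠
        (mu.1.cells.filter fun c => c.1 < r).card := by
      by_contra! hall
      exact h (level_ext_of_card_filter fun r => (hall r).symm)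
    obtain ⟨r, hr⟩ := h0
    rcases lt_or_gt_of_ne hr with hr | hr
    · have hsub : Subsingleton (Representation.IntertwiningMap (specht lam).toRepresentation
          (specht mu).toRepresentation) :=
        subsingleton_of_forall_eq 0 fun f =>
          intertwiningMap_eq_zero f (nonempty_tableau lam).some ⟨r, hr⟩
      rw [Module.finrank_zero_of_subsingleton, Nat.cast_zero] at key2
      rw [hswap]
      exact (mul_eq_zero.1 key2).resolve_left (inv_ne_zero hne)
    · have hsub : Subsingleton (Representation.IntertwiningMap (specht mu).toRepresentation
          (specht lam).toRepresentation) :=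
        subsingleton_of_forall_eq 0 fun f =>
          intertwiningMap_eq_zero f (nonempty_tableau mu).some ⟨r, hr⟩
      rw [Module.finrank_zero_of_subsingleton, Nat.cast_zero] at key1
      exact (mul_eq_zero.1 key1).resolve_left (inv_ne_zero hne)

/-! ### Characters are real valued class functions -/

theorem chi_conj {n : ℕ} (lam : Level n) (g h : Perm (Fin n)) :
    chi lam (h * g * h⁻¹) = chi lam g := by
  have key := Representation.char_conj (G := Perm (Fin n)) (k := ℂ)
    (V := (specht lam).toSubmodule) (specht lam).toRepresentation g h
  exact key

theorem chi_eq_of_isConj {n : ℕ} (lam : Level n) {g h : Perm (Fin n)} (hgh : IsConj g h) :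
    chi lam g = chi lam h := by
  obtain ⟨c, rfl⟩ := isConj_iff.1 hgh
  exact (chi_conj lam g c).symm

/-- In `S_n` a permutation and its inverse have the same cycle type. -/
theorem chi_inv {n : ℕ} (lam : Level n) (g : Perm (Fin n)) : chi lam g⁻¹ = chi lam g :=
  chi_eq_of_isConj lam (Perm.isConj_iff_cycleType_eq.2 (Perm.cycleType_inv g))

theorem chi_one {n : ℕ} (lam : Level n) : chi lam 1 = (dim lam : ℂ) := by
  have key := Representation.char_one (G := Perm (Fin n)) (k := ℂ)
    (V := (specht lam).toSubmodule) (specht lam).toRepresentation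
  exact key

theorem dim_pos {n : ℕ} (lam : Level n) : 0 < dim lam := by
  obtain ⟨t⟩ := nonempty_tableau lam
  have : Nontrivial (specht lam).toSubmodule := ⟨t.spechtVec, 0, t.spechtVec_ne_zero⟩
  exact Module.finrank_pos (R := ℂ) (M := (specht lam).toSubmodule)

/-- Coefficientwise complex conjugation. -/
noncomputable def conjCoeff (n : ℕ) : ((Fin n → ℕ) →₀ ℂ) →+ ((Fin n → ℕ) →₀ ℂ) :=
  Finsupp.mapRange.addMonoidHom (starRingEnd ℂ).toAddMonoidHom

theorem conjCoeff_smul {n : ℕ} (c : ℂ) (v : (Fin n → ℕ) →₀ ℂ) :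
    conjCoeff n (c • v) = starRingEnd ℂ c • conjCoeff n v := by
  ext f
  simp [conjCoeff]

theorem conjCoeff_polytabloid {n : ℕ} {lam : Level n} (t : Tableau lam) :
    conjCoeff n t.polytabloid = t.polytabloid := by
  rw [Tableau.polytabloid, map_sum]
  refine Finset.sum_congr rfl fun q _ => ?_
  simp [conjCoeff]

/-- Polytabloids have integer coefficients and are permuted by the group. In a basis made of
polytabloids each group element therefore has a real matrix: conjugating the expansion of a
polytabloid gives another expansion of it. -/
theorem conj_chi {n : ℕ} (lam : Level n) (g : Perm (Fin n)) :
    starRingEnd ℂ (chi lam g) = chi lam g := by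
  obtain ⟨s, hs, hspan, hli⟩ := exists_linearIndependent ℂ
    (Set.range fun t : Tableau lam => t.spechtVec)
  rw [span_spechtVec] at hspan
  let b : Module.Basis s ℂ (specht lam).toSubmodule :=
    Module.Basis.mk hli (by rw [Subtype.range_coe, hspan])
  have : Fintype s := ((Set.finite_range _).subset hs).fintype
  classical
  have hb : ∀ i, ∃ t : Tableau lam, b i = t.spechtVec := by
    intro i
    obtain ⟨t, ht⟩ := hs i.2
    exact ⟨t, by rw [Module.Basis.mk_apply]; exact ht.symm⟩
  have hconj : ∀ i, conjCoeff n (b i).1 = (b i).1 := by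
    intro i
    obtain ⟨t, ht⟩ := hb i
    rw [ht]
    exact conjCoeff_polytabloid t
  have hreal : ∀ t : Tableau lam, ∀ i,
      starRingEnd ℂ (b.repr t.spechtVec i) = b.repr t.spechtVec i := by
    intro t i
    have h1 : ∑ i, b.repr t.spechtVec i • (b i).1 = t.polytabloid := by
      have := congrArg Subtype.val (b.sum_repr t.spechtVec)
      rwa [AddSubmonoidClass.coe_finsetSum] at this
    have h2 : ∑ i, starRingEnd ℂ (b.repr t.spechtVec i) • (b i).1 = t.polytabloid := by
      have := congrArg (conjCoeff n) h1
      rw [conjCoeff_polytabloid, map_sum] at this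
      simpa only [conjCoeff_smul, hconj] using this
    have h3 : ∑ i, starRingEnd ℂ (b.repr t.spechtVec i) • b i = t.spechtVec := by
      refine Subtype.ext ?_
      rw [AddSubmonoidClass.coe_finsetSum]
      exact h2
    conv_rhs => rw [← h3, b.repr_sum_self]
  rw [chi, LinearMap.trace_eq_matrix_trace ℂ b, Matrix.trace, map_sum]
  refine Finset.sum_congr rfl fun i _ => ?_
  rw [Matrix.diag_apply, LinearMap.toMatrix_apply]
  obtain ⟨t, ht⟩ := hb i
  rw [ht, t.toRepresentation_spechtVec]
  exact hreal _ _

/-- The real character value. -/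
noncomputable def chiRe {n : ℕ} (lam : Level n) (g : Perm (Fin n)) : ℝ := (chi lam g).re

theorem ofReal_chiRe {n : ℕ} (lam : Level n) (g : Perm (Fin n)) :
    (chiRe lam g : ℂ) = chi lam g :=
  Complex.conj_eq_iff_re.1 (conj_chi lam g)

theorem chiRe_eq_of_isConj {n : ℕ} (lam : Level n) {g h : Perm (Fin n)} (hgh : IsConj g h) :
    chiRe lam g = chiRe lam h := by
  rw [chiRe, chiRe, chi_eq_of_isConj lam hgh]

theorem chiRe_one {n : ℕ} (lam : Level n) : chiRe lam 1 = dim lam := by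
  rw [chiRe, chi_one, Complex.natCast_re]

theorem sum_chiRe_mul_chiRe {n : ℕ} (lam mu : Level n) :
    ∑ g, chiRe lam g * chiRe mu g = if lam = mu then (n.factorial : ℝ) else 0 := by
  have h := sum_chi_mul_chi_inv lam mu
  refine Complex.ofReal_injective ?_
  simp only [chi_inv] at h
  simp only [Complex.ofReal_sum, Complex.ofReal_mul, ofReal_chiRe, h]
  split_ifs <;> simp

/-! ### Completeness of the characters -/

theorem card_cellsOfRowLens (w : List ℕ) :
    (YoungDiagram.cellsOfRowLens w).card = w.sum := by
  induction w with
  | nil => rfl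
  | cons a w ih =>
    rw [YoungDiagram.cellsOfRowLens, Finset.card_union_of_disjoint, Finset.card_map, ih,
      Finset.card_product, Finset.card_singleton, Finset.card_range, one_mul, List.sum_cons]
    refine Finset.disjoint_left.2 fun c hc hc' => ?_
    obtain ⟨d, -, rfl⟩ := Finset.mem_map.1 hc'
    exact Nat.succ_ne_zero _ (Finset.mem_singleton.1 (Finset.mem_product.1 hc).1)

/-- The Young diagram whose row lengths are the parts of a partition. -/
noncomputable def levelOfPartition {n : ℕ} (p : n.Partition) : Level n :=
  ⟨YoungDiagram.ofRowLens (p.parts.sort (· ≥ ·)) (p.parts.pairwise_sort (· ≥ ·)).sortedGE, by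
    refine (card_cellsOfRowLens _).trans ?_
    rw [← Multiset.sum_coe, Multiset.sort_eq, p.parts_sum]⟩

theorem levelOfPartition_injective (n : ℕ) :
    Function.Injective (levelOfPartition : n.Partition → Level n) := by
  intro p p' h
  have hpos : ∀ p : n.Partition, ∀ x ∈ p.parts.sort (· ≥ ·), 0 < x := fun p x hx =>
    p.parts_pos ((Multiset.mem_sort _).1 hx)
  have h2 := congrArg (fun l : Level n => l.1.rowLens) h
  simp only [levelOfPartition] at h2
  rw [YoungDiagram.rowLens_ofRowLens_eq_self (hpos p),
    YoungDiagram.rowLens_ofRowLens_eq_self (hpos p')] at h2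
  refine Nat.Partition.ext ?_
  rw [← Multiset.sort_eq p.parts (· ≥ ·), h2, Multiset.sort_eq]

/-- Conjugacy classes are separated by cycle type, and partitions by the rows of their diagrams. -/
theorem exists_injective_conjClasses_level (n : ℕ) :
    ∃ f : ConjClasses (Perm (Fin n)) → Level n, Function.Injective f := by
  let f : ConjClasses (Perm (Fin n)) → (Fintype.card (Fin n)).Partition :=
    Quotient.lift Perm.partition fun _ _ h => Perm.partition_eq_of_isConj.1 h
  have hf : Function.Injective f := by
    intro C C' h
    obtain ⟨g, rfl⟩ := ConjClasses.mk_surjective C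
    obtain ⟨g', rfl⟩ := ConjClasses.mk_surjective C'
    exact ConjClasses.mk_eq_mk_iff_isConj.2 (Perm.partition_eq_of_isConj.2 h)
  have h : ∃ f : ConjClasses (Perm (Fin n)) → Level (Fintype.card (Fin n)),
      Function.Injective f := ⟨_, (levelOfPartition_injective _).comp hf⟩
  rwa [Fintype.card_fin] at h

/-- The size of the conjugacy class of `g`. -/
noncomputable def classSize {n : ℕ} (g : Perm (Fin n)) : ℝ :=
  Nat.card (ConjClasses.mk g).carrier

theorem classSize_pos {n : ℕ} (g : Perm (Fin n)) : 0 < classSize g :=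
  Nat.cast_pos.2 (Nat.card_pos_iff.2 ⟨⟨g, ConjClasses.mem_carrier_mk⟩, inferInstance⟩)

theorem sum_filter_isConj {n : ℕ} (g : Perm (Fin n)) {f : Perm (Fin n) → ℝ}
    (hf : ∀ h, IsConj g h → f h = f g) [DecidablePred (IsConj g)] :
    ∑ h with IsConj g h, f h = classSize g * f g := by
  rw [Finset.sum_congr rfl fun h hh => hf h (Finset.mem_filter.1 hh).2, Finset.sum_const,
    nsmul_eq_mul, classSize, Nat.card_eq_card_toFinset]
  congr 3
  ext h
  rw [Finset.mem_filter_univ, Set.mem_toFinset, ConjClasses.mem_carrier_iff_mk_eq,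
    ConjClasses.mk_eq_mk_iff_isConj, isConj_comm]

/-- The normalized character table. -/
noncomputable def charTable (n : ℕ) : Matrix (Level n) (ConjClasses (Perm (Fin n))) ℝ :=
  Matrix.of fun lam C =>
    Real.sqrt (classSize (Quotient.out C)) * chiRe lam (Quotient.out C) / Real.sqrt n.factorial

theorem charTable_mk {n : ℕ} (lam : Level n) (g : Perm (Fin n)) :
    charTable n lam (ConjClasses.mk g) =
      Real.sqrt (classSize g) * chiRe lam g / Real.sqrt n.factorial := by
  have h : ConjClasses.mk (Quotient.out (ConjClasses.mk g)) = ConjClasses.mk g :=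
    Quotient.out_eq _
  rw [charTable, Matrix.of_apply, classSize, h, classSize,
    chiRe_eq_of_isConj lam (ConjClasses.mk_eq_mk_iff_isConj.1 h)]

open Classical in
-- Grouping the sum over the group by conjugacy classes turns row orthogonality into this identity;
-- the class sizes are absorbed by the square roots.
theorem charTable_mul_transpose (n : ℕ) : charTable n * (charTable n).transpose = 1 := by
  ext lam mu
  have hfac : (0 : ℝ) < n.factorial := Nat.cast_pos.2 n.factorial_pos
  have h : ∑ C, charTable n lam C * charTable n mu C =
      (∑ g, chiRe lam g * chiRe mu g) / n.factorial := by
    rw [Finset.sum_div, ← Finset.sum_fiberwise _ (fun g => ConjClasses.mk g)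
      (fun g => chiRe lam g * chiRe mu g / n.factorial)]
    refine Finset.sum_congr rfl fun C _ => ?_
    obtain ⟨g, rfl⟩ := ConjClasses.mk_surjective C
    have hcl := sum_filter_isConj g (f := fun g => chiRe lam g * chiRe mu g / n.factorial)
      fun h hh => by rw [chiRe_eq_of_isConj lam hh, chiRe_eq_of_isConj mu hh]
    simp only [ConjClasses.mk_eq_mk_iff_isConj, isConj_comm (h := g)]
    rw [hcl, charTable_mk, charTable_mk, div_mul_div_comm, Real.mul_self_sqrt hfac.le,
      mul_mul_mul_comm, Real.mul_self_sqrt (classSize_pos g).le, mul_div_assoc]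
  rw [Matrix.mul_apply]
  simp only [Matrix.transpose_apply]
  rw [h, sum_chiRe_mul_chiRe, Matrix.one_apply]
  split_ifs
  · exact div_self hfac.ne'
  · exact zero_div _

/-- One inequality is a rank bound, as the orthonormal rows are independent; the other is the
injection by cycle type. -/
theorem card_level_eq_card_conjClasses (n : ℕ) :
    Fintype.card (Level n) = Fintype.card (ConjClasses (Perm (Fin n))) := by
  refine le_antisymm ?_ ?_
  · have h := congrArg Matrix.rank (charTable_mul_transpose n)
    rw [Matrix.rank_one] at h
    rw [← h]
    exact (Matrix.rank_mul_le_left _ _).trans (Matrix.rank_le_card_width _)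
  · obtain ⟨f, hf⟩ := exists_injective_conjClasses_level n
    exact Fintype.card_le_of_injective f hf

open Classical in
theorem transpose_mul_charTable (n : ℕ) : (charTable n).transpose * charTable n = 1 :=
  (Matrix.mul_eq_one_comm_of_card_eq _ _ _ (card_level_eq_card_conjClasses n)).1
    (charTable_mul_transpose n)

open Classical in
/-- Column orthogonality. -/
theorem sum_chiRe_mul_chiRe_level {n : ℕ} (g h : Perm (Fin n)) :
    ∑ lam, chiRe lam g * chiRe lam h = if IsConj g h then n.factorial / classSize g else 0 := by
  have hfac : (0 : ℝ) < n.factorial := Nat.cast_pos.2 n.factorial_pos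
  have hg := classSize_pos g
  have hh := classSize_pos h
  have key : (∑ lam, chiRe lam g * chiRe lam h) *
      (Real.sqrt (classSize g) * Real.sqrt (classSize h)) / n.factorial =
        if IsConj g h then 1 else 0 := by
    have h1 := congrFun (congrFun (transpose_mul_charTable n) (ConjClasses.mk g))
      (ConjClasses.mk h)
    rw [Matrix.mul_apply, Matrix.one_apply] at h1
    simp only [Matrix.transpose_apply, ConjClasses.mk_eq_mk_iff_isConj] at h1
    rw [← h1, Finset.sum_mul, Finset.sum_div]
    refine Finset.sum_congr rfl fun lam _ => ?_
    rw [charTable_mk, charTable_mk, div_mul_div_comm, Real.mul_self_sqrt hfac.le]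
    ring
  split_ifs at key ⊢ with hc
  · have : classSize h = classSize g := by
      rw [classSize, classSize, ConjClasses.mk_eq_mk_iff_isConj.2 hc]
    rw [this, Real.mul_self_sqrt hg.le] at key
    field_simp at key ⊢
    exact key
  · have := Real.sqrt_pos.2 hg
    have := Real.sqrt_pos.2 hh
    rw [div_eq_zero_iff, mul_eq_zero] at key
    rcases key with (key | key) | key
    · exact key
    · exact absurd key (by positivity)
    · exact absurd key hfac.ne'

/-! ### The embedding of `S_n` in `S_{n+1}` -/

/-- The embedding of `S_n` in `S_{n+1}` as the stabilizer of the last point. -/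
noncomputable def embedPerm (n : ℕ) : Perm (Fin n) →* Perm (Fin (n + 1)) :=
  Perm.extendDomainHom (finSuccAboveEquiv (Fin.last n))

theorem embedPerm_castSucc {n : ℕ} (g : Perm (Fin n)) (i : Fin n) :
    embedPerm n g i.castSucc = (g i).castSucc := by
  have h := Perm.extendDomain_apply_image g (finSuccAboveEquiv (Fin.last n)) i
  simp only [finSuccAboveEquiv_apply, Fin.succAbove_last] at h
  exact h

theorem embedPerm_last {n : ℕ} (g : Perm (Fin n)) : embedPerm n g (Fin.last n) = Fin.last n :=
  Perm.extendDomain_apply_not_subtype g (finSuccAboveEquiv (Fin.last n)) fun h => h rfl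

theorem embedPerm_symm_castSucc {n : ℕ} (g : Perm (Fin n)) (i : Fin n) :
    (embedPerm n g).symm i.castSucc = (g.symm i).castSucc := by
  rw [symm_apply_eq, embedPerm_castSucc, apply_symm_apply]

theorem embedPerm_symm_last {n : ℕ} (g : Perm (Fin n)) :
    (embedPerm n g).symm (Fin.last n) = Fin.last n := by
  rw [symm_apply_eq, embedPerm_last]

theorem embedPerm_injective (n : ℕ) : Function.Injective (embedPerm n) :=
  Perm.extendDomainHom_injective _

theorem cycleType_embedPerm {n : ℕ} (g : Perm (Fin n)) :
    (embedPerm n g).cycleType = g.cycleType :=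
  Perm.cycleType_extendDomain _

theorem sign_embedPerm {n : ℕ} (g : Perm (Fin n)) :
    Perm.sign (embedPerm n g) = Perm.sign g :=
  Perm.sign_extendDomain g _

theorem isConj_embedPerm_iff {n : ℕ} {g h : Perm (Fin n)} :
    IsConj (embedPerm n g) (embedPerm n h) ↔ IsConj g h := by
  rw [Perm.isConj_iff_cycleType_eq, Perm.isConj_iff_cycleType_eq, cycleType_embedPerm,
    cycleType_embedPerm]

theorem exists_embedPerm_eq {n : ℕ} {g : Perm (Fin (n + 1))} (hg : g (Fin.last n) = Fin.last n) :
    ∃ h, embedPerm n h = g := by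
  have hne : ∀ i : Fin n, g i.castSucc ≠ Fin.last n := fun i h =>
    Fin.castSucc_ne_last i (g.injective (h.trans hg.symm))
  have hinj : Function.Injective fun i : Fin n => (g i.castSucc).castPred (hne i) := by
    intro i j hij
    exact Fin.castSucc_injective n (g.injective (Fin.castPred_inj.1 hij))
  refine ⟨Equiv.ofBijective _ (Finite.injective_iff_bijective.1 hinj), ?_⟩
  ext1 i
  induction i using Fin.lastCases with
  | last => rw [embedPerm_last, hg]
  | cast i => rw [embedPerm_castSucc, Equiv.ofBijective_apply, Fin.castSucc_castPred]

/-! ### Removing the last entry of a tabloid -/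

/-- The linear map that removes the last entry from each tabloid having it in row `r`, and
kills the other tabloids. -/
noncomputable def restrictRow (n r : ℕ) :
    ((Fin (n + 1) → ℕ) →₀ ℂ) →ₗ[ℂ] ((Fin n → ℕ) →₀ ℂ) :=
  Finsupp.linearCombination ℂ fun F =>
    if F (Fin.last n) = r then Finsupp.single (F ∘ Fin.castSucc) 1 else 0

theorem restrictRow_single (n r : ℕ) (F : Fin (n + 1) → ℕ) (c : ℂ) :
    restrictRow n r (Finsupp.single F c) =
      if F (Fin.last n) = r then Finsupp.single (F ∘ Fin.castSucc) c else 0 := by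
  rw [restrictRow, Finsupp.linearCombination_single]
  split_ifs
  · rw [Finsupp.smul_single, smul_eq_mul, mul_one]
  · rw [smul_zero]

theorem restrictRow_tabloidRep (n r : ℕ) (g : Perm (Fin n)) (v : (Fin (n + 1) → ℕ) →₀ ℂ) :
    restrictRow n r (tabloidRep (n + 1) (embedPerm n g) v) =
      tabloidRep n g (restrictRow n r v) := by
  induction v using Finsupp.induction_linear with
  | zero => simp only [map_zero]
  | add v w hv hw => simp only [map_add, hv, hw]
  | single F c =>
    have h : (F ∘ (embedPerm n g).symm) ∘ Fin.castSucc = (F ∘ Fin.castSucc) ∘ g.symm := by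
      funext i
      simp only [Function.comp_apply, embedPerm_symm_castSucc]
    rw [tabloidRep_single, restrictRow_single, restrictRow_single, h, Function.comp_apply,
      embedPerm_symm_last]
    split_ifs
    · rw [tabloidRep_single]
    · rw [map_zero]

/-- A surviving term keeps the last entry in its row. A column permutation also keeps it in its
column, so it fixes the last entry and comes from the column stabilizer of `t`. -/
theorem restrictRow_polytabloid {n : ℕ} {tau : Level n} {lam : Level (n + 1)}
    (t : Tableau tau) (T : Tableau lam) (hT : ∀ a, (T (Fin.castSucc a)).1 = (t a).1) :
    restrictRow n (T (Fin.last n)).1.1 T.polytabloid = t.polytabloid := by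
  rw [Tableau.polytabloid, Tableau.polytabloid, map_sum]
  symm
  refine Finset.sum_of_injOn (embedPerm n) (embedPerm_injective n).injOn ?_ ?_ ?_
  · intro q hq
    refine Finset.mem_coe.2 (Tableau.mem_columnStabilizer.2 fun a => ?_)
    induction a using Fin.lastCases with
    | last => rw [embedPerm_last]
    | cast a =>
      rw [embedPerm_castSucc, hT, hT]
      exact Tableau.mem_columnStabilizer.1 hq a
  · intro q hq hnot
    rw [restrictRow_single, if_neg]
    intro hrow
    have hcol := Tableau.mem_columnStabilizer.1 (Tableau.inv_mem_columnStabilizer hq) (Fin.last n)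
    have hfix : q.symm (Fin.last n) = Fin.last n :=
      T.injective (Subtype.ext (Prod.ext hrow hcol))
    obtain ⟨p, rfl⟩ := exists_embedPerm_eq ((symm_apply_eq q).1 hfix).symm
    refine hnot ⟨p, Finset.mem_coe.2 (Tableau.mem_columnStabilizer.2 fun a => ?_), rfl⟩
    have := Tableau.mem_columnStabilizer.1 hq a.castSucc
    rwa [embedPerm_castSucc, hT, hT] at this
  · intro q _
    have h1 : (T.perm (embedPerm n q)).tabloid (Fin.last n) = (T (Fin.last n)).1.1 := by
      change (T ((embedPerm n q).symm (Fin.last n))).1.1 = _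
      rw [embedPerm_symm_last]
    have h2 : (T.perm (embedPerm n q)).tabloid ∘ Fin.castSucc = (t.perm q).tabloid := by
      funext a
      change (T ((embedPerm n q).symm a.castSucc)).1.1 = (t (q.symm a)).1.1
      rw [embedPerm_symm_castSucc, hT]
    rw [restrictRow_single, if_pos h1, h2, sign_embedPerm]

theorem Tableau.exists_extend {n : ℕ} {tau : Level n} {lam : Level (n + 1)}
    (h : tau.1 ≤ lam.1) (t : Tableau tau) :
    ∃ T : Tableau lam, ∀ a, (T (Fin.castSucc a)).1 = (t a).1 := by
  have hsub := YoungDiagram.cells_subset_iff.2 h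
  have hcard : (lam.1.cells \ tau.1.cells).card = 1 := by
    rw [Finset.card_sdiff_of_subset hsub]
    have h1 : lam.1.cells.card = n + 1 := lam.2
    have h2 : tau.1.cells.card = n := tau.2
    omega
  obtain ⟨c, hc⟩ := Finset.card_pos.1 (hcard ▸ one_pos)
  obtain ⟨hc1, hc2⟩ := Finset.mem_sdiff.1 hc
  let u : Fin (n + 1) → {c // c ∈ lam.1.cells} :=
    Fin.snoc (α := fun _ => {c // c ∈ lam.1.cells}) (fun a => ⟨(t a).1, hsub (t a).2⟩) ⟨c, hc1⟩
  have hlast : u (Fin.last n) = ⟨c, hc1⟩ := Fin.snoc_last _ _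
  have hcast : ∀ a : Fin n, u a.castSucc = ⟨(t a).1, hsub (t a).2⟩ := fun a =>
    Fin.snoc_castSucc _ _ _
  have hne : ∀ a : Fin n, u a.castSucc ≠ u (Fin.last n) := by
    intro a ha
    rw [hlast, hcast] at ha
    exact hc2 (Subtype.mk.inj ha ▸ (t a).2)
  have hinj : Function.Injective u := by
    intro a b hab
    induction a using Fin.lastCases with
    | last =>
      induction b using Fin.lastCases with
      | last => rfl
      | cast b => exact absurd hab.symm (hne b)
    | cast a =>
      induction b using Fin.lastCases with
      | last => exact absurd hab (hne a)
      | cast b =>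
        rw [hcast, hcast] at hab
        rw [t.injective (Subtype.ext (Subtype.mk.inj hab))]
  have hbij : Function.Bijective u := by
    rw [Fintype.bijective_iff_injective_and_card]
    refine ⟨hinj, ?_⟩
    rw [Fintype.card_fin, Fintype.card_coe]
    exact lam.2.symm
  exact ⟨Equiv.ofBijective u hbij, fun a => congrArg Subtype.val (hcast a)⟩

/-! ### Multiplicities in restricted Specht modules -/

/-- Maschke: the projection along an invariant complement is equivariant. -/
theorem exists_equivariant_projection {n : ℕ} (lam : Level n) :
    ∃ p : ((Fin n → ℕ) →₀ ℂ) →ₗ[ℂ] (specht lam).toSubmodule,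
      (∀ g v, p (tabloidRep n g v) = (specht lam).toRepresentation g (p v)) ∧
        ∀ x : (specht lam).toSubmodule, p x = x := by
  have : NeZero (Nat.card (Perm (Fin n)) : ℂ) :=
    ⟨Nat.cast_ne_zero.2 Nat.card_pos.ne'⟩
  obtain ⟨σ, hσ⟩ := exists_isCompl (specht lam)
  have hc : IsCompl (specht lam).toSubmodule σ.toSubmodule := by
    constructor
    · rw [disjoint_iff, ← Subrepresentation.toSubmodule_inf, hσ.inf_eq_bot]
      rfl
    · rw [codisjoint_iff, ← Subrepresentation.toSubmodule_sup, hσ.sup_eq_top]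
      rfl
  refine ⟨Submodule.projectionOnto _ _ hc, fun g v => ?_,
    fun x => Submodule.projectionOnto_apply_left hc x⟩
  obtain ⟨a, ha, b, hb, rfl⟩ := Submodule.mem_sup.1 (hc.sup_eq_top ▸ Submodule.mem_top (x := v))
  rw [map_add, map_add, map_add]
  rw [(Submodule.projectionOnto_apply_eq_zero_iff hc).2 hb,
    (Submodule.projectionOnto_apply_eq_zero_iff hc).2 (σ.apply_mem_toSubmodule g hb),
    add_zero, add_zero]
  have h1 := Submodule.projectionOnto_apply_left hc ⟨a, ha⟩
  have h2 := Submodule.projectionOnto_apply_left hc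
    ⟨_, (specht lam).apply_mem_toSubmodule g ha⟩
  rw [h2]
  exact (congrArg ((specht lam).toRepresentation g) h1).symm

/-- The multiplicity of `S^tau` in the restriction of `S^lam`. -/
noncomputable def mult {n : ℕ} (tau : Level n) (lam : Level (n + 1)) : ℝ :=
  (∑ h, chiRe tau h * chiRe lam (embedPerm n h)) / n.factorial

/-- This makes `mult` a natural number, so that a single nonzero homomorphism bounds it below by 1.
-/
theorem mult_eq_finrank {n : ℕ} (tau : Level n) (lam : Level (n + 1)) :
    mult tau lam = Module.finrank ℂ (Representation.IntertwiningMap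
      ((specht lam).toRepresentation.comp (embedPerm n)) (specht tau).toRepresentation) := by
  have hcard : Nat.card (Perm (Fin n)) = n.factorial := by
    rw [Nat.card_eq_fintype_card, Fintype.card_perm, Fintype.card_fin]
  have hne : (n.factorial : ℂ) ≠ 0 := Nat.cast_ne_zero.2 n.factorial_ne_zero
  have : Invertible (Nat.card (Perm (Fin n)) : ℂ) := invertibleOfNonzero (by rwa [hcard])
  have key := Representation.card_inv_mul_sum_char_mul_char_eq_finrank
    (G := Perm (Fin n)) (k := ℂ) (V := (specht lam).toSubmodule) (W := (specht tau).toSubmodule)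
    ((specht lam).toRepresentation.comp (embedPerm n)) (specht tau).toRepresentation
  have key' : (Nat.card (Perm (Fin n)) : ℂ)⁻¹ *
      ∑ g, chi tau g * chi lam (embedPerm n g⁻¹) = _ := key
  refine Complex.ofReal_injective ?_
  rw [Complex.ofReal_natCast, ← key', hcard, mult, Complex.ofReal_div, Complex.ofReal_sum,
    div_eq_inv_mul, Complex.ofReal_natCast]
  congr 1
  refine Finset.sum_congr rfl fun g _ => ?_
  rw [map_inv, chi_inv, Complex.ofReal_mul, ofReal_chiRe, ofReal_chiRe]

theorem finrank_intertwiningMap_ne_zero {G V W : Type*} [Group G] [AddCommGroup V]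
    [Module ℂ V] [FiniteDimensional ℂ V] [AddCommGroup W] [Module ℂ W] [FiniteDimensional ℂ W]
    {ρ : Representation ℂ G V} {σ : Representation ℂ G W} {f : Representation.IntertwiningMap ρ σ}
    {v : V} (hf : f v ≠ 0) : Module.finrank ℂ (Representation.IntertwiningMap ρ σ) ≠ 0 := by
  have : Nontrivial (Representation.IntertwiningMap ρ σ) :=
    ⟨f, 0, fun h => hf (by rw [h, Representation.IntertwiningMap.coe_zero, Pi.zero_apply])⟩
  exact Module.finrank_pos.ne'

theorem edge_le_mult {n : ℕ} (tau : Level n) (lam : Level (n + 1)) :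
    edge tau lam ≤ mult tau lam := by
  rw [mult_eq_finrank, edge]
  split_ifs with h
  · rw [Nat.one_le_cast, Nat.one_le_iff_ne_zero]
    obtain ⟨p, hp, hpx⟩ := exists_equivariant_projection tau
    obtain ⟨t⟩ := nonempty_tableau tau
    obtain ⟨T, hT⟩ := t.exists_extend h
    -- `restrictRow` is only known to send one polytabloid into `S^tau`; composing with `p` makes
    -- all values land there without changing that one.
    let f : Representation.IntertwiningMap ((specht lam).toRepresentation.comp (embedPerm n))
        (specht tau).toRepresentation :=
      { p ∘ₗ restrictRow n (T (Fin.last n)).1.1 ∘ₗ (specht lam).toSubmodule.subtype with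
        isIntertwining' := fun g => by
          ext1 v
          exact (congrArg p (restrictRow_tabloidRep n _ g v.1)).trans (hp g _) }
    have hf : f T.spechtVec = t.spechtVec :=
      (congrArg p (restrictRow_polytabloid t T hT)).trans (hpx t.spechtVec)
    have key := finrank_intertwiningMap_ne_zero (G := Perm (Fin n))
      (V := (specht lam).toSubmodule) (W := (specht tau).toSubmodule) (f := f)
      (v := T.spechtVec) (hf ▸ t.spechtVec_ne_zero)
    exact key
  · exact Nat.cast_nonneg _

/-! ### Combinatorics of the Young lattice -/

/-- The hypothesis says that row `i` is strictly shorter than the row above; it is void for `i = 0`.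
-/
theorem exists_addBox {n : ℕ} (tau : Level n) {i : ℕ}
    (hi : ∀ j, i = j + 1 → tau.1.rowLen i < tau.1.rowLen j) :
    ∃ lam : Level (n + 1), lam.1.cells = insert (i, tau.1.rowLen i) tau.1.cells := by
  refine ⟨⟨⟨insert (i, tau.1.rowLen i) tau.1.cells, ?_⟩, ?_⟩, rfl⟩
  · rintro ⟨a, b⟩ ⟨a', b'⟩ ⟨ha, hb⟩ h
    simp only at ha hb
    simp only [Finset.coe_insert, Set.mem_insert_iff, Prod.mk.injEq, Finset.mem_coe,
      YoungDiagram.mem_cells, YoungDiagram.mem_iff_lt_rowLen] at h ⊢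
    rcases h with ⟨rfl, rfl⟩ | h
    · rcases ha.eq_or_lt with rfl | hlt
      · omega
      · obtain ⟨j, rfl⟩ : ∃ j, a = j + 1 := ⟨a - 1, by omega⟩
        have h1 := hi j rfl
        have h2 := tau.1.rowLen_anti a' j (by omega)
        omega
    · have := tau.1.rowLen_anti a' a ha
      omega
  · refine (Finset.card_insert_of_notMem fun h => ?_).trans (congrArg (· + 1) tau.2)
    exact lt_irrefl _ (YoungDiagram.mem_iff_lt_rowLen.1 h)

theorem exists_erase {n : ℕ} {sigma : Level n} {tau : Level (n + 1)} (h : sigma.1 ≤ tau.1) :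
    ∃ r, tau.1.rowLen (r + 1) < tau.1.rowLen r ∧
      sigma.1.cells = tau.1.cells.erase (r, tau.1.rowLen r - 1) := by
  have hsub := YoungDiagram.cells_subset_iff.2 h
  have hcard : (tau.1.cells \ sigma.1.cells).card = 1 := by
    rw [Finset.card_sdiff_of_subset hsub]
    have h1 : tau.1.cells.card = n + 1 := tau.2
    have h2 : sigma.1.cells.card = n := sigma.2
    omega
  obtain ⟨⟨r, b⟩, hc⟩ := Finset.card_eq_one.1 hcard
  have hs : sigma.1.cells = tau.1.cells.erase (r, b) := by
    rw [← Finset.sdiff_singleton_eq_erase, ← hc, Finset.sdiff_sdiff_eq_self hsub]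
  have hmem : ∀ i j, j < sigma.1.rowLen i ↔ (i, j) ≠ (r, b) ∧ j < tau.1.rowLen i := by
    intro i j
    rw [← YoungDiagram.mem_iff_lt_rowLen, ← YoungDiagram.mem_iff_lt_rowLen,
      ← YoungDiagram.mem_cells, hs, Finset.mem_erase, YoungDiagram.mem_cells]
  have hb : b < tau.1.rowLen r := by
    rw [← YoungDiagram.mem_iff_lt_rowLen, ← YoungDiagram.mem_cells]
    exact (Finset.mem_sdiff.1 (hc ▸ Finset.mem_singleton_self _)).1
  have hb' : ¬ b < sigma.1.rowLen r := fun h => ((hmem r b).1 h).1 rfl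
  have h1 : ¬ b + 1 < tau.1.rowLen r := by
    intro h
    have := (hmem r (b + 1)).2 ⟨by simp, h⟩
    omega
  have h2 : ¬ b < tau.1.rowLen (r + 1) := by
    intro h
    have h3 := (hmem (r + 1) b).2 ⟨by simp, h⟩
    have := sigma.1.rowLen_anti r (r + 1) (Nat.le_succ r)
    omega
  refine ⟨r, by omega, ?_⟩
  rw [hs, show tau.1.rowLen r - 1 = b by omega]

open Classical in
theorem sum_edge_above {n : ℕ} (tau tau' : Level n) :
    ∑ lam, edge tau lam * edge tau' lam =
      (Finset.univ.filter fun lam : Level (n + 1) => tau.1 ≤ lam.1 ∧ tau'.1 ≤ lam.1).card := by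
  rw [Finset.card_filter, Nat.cast_sum]
  refine Finset.sum_congr rfl fun lam _ => ?_
  rw [edge, edge]
  split_ifs <;> simp_all

open Classical in
theorem sum_edge_below {n : ℕ} (tau tau' : Level (n + 1)) :
    ∑ sigma, edge sigma tau * edge sigma tau' =
      (Finset.univ.filter fun sigma : Level n => sigma.1 ≤ tau.1 ∧ sigma.1 ≤ tau'.1).card := by
  rw [Finset.card_filter, Nat.cast_sum]
  refine Finset.sum_congr rfl fun lam _ => ?_
  rw [edge, edge]
  split_ifs <;> simp_all

theorem edge_nonneg {n : ℕ} (tau : Level n) (lam : Level (n + 1)) : 0 ≤ edge tau lam := by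
  rw [edge]
  split_ifs <;> norm_num

theorem one_le_sum_edge_above {n : ℕ} (tau : Level n) :
    1 ≤ ∑ lam, edge tau lam * edge tau lam := by
  classical
  rw [sum_edge_above, Nat.one_le_cast, Nat.one_le_iff_ne_zero]
  obtain ⟨lam, hlam⟩ := exists_addBox tau (i := 0) (fun j hj => absurd hj (by omega))
  refine Finset.card_ne_zero_of_mem (a := lam) (Finset.mem_filter.2 ⟨Finset.mem_univ _, ?_⟩)
  rw [and_self, ← YoungDiagram.cells_subset_iff, hlam]
  exact Finset.subset_insert _ _

open Classical in
-- If the last box of row `r` is removable, then a box can be added to row `r + 1`; row `0` always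
-- accepts one more.
theorem card_below_lt_card_above {n : ℕ} (tau : Level (n + 1)) :
    (Finset.univ.filter fun sigma : Level n => sigma.1 ≤ tau.1).card + 1 ≤
      (Finset.univ.filter fun lam : Level (n + 1 + 1) => tau.1 ≤ lam.1).card := by
  let R := (Finset.range (n + 1)).filter fun r => tau.1.rowLen (r + 1) < tau.1.rowLen r
  have hR : (Finset.univ.filter fun sigma : Level n => sigma.1 ≤ tau.1).card ≤ R.card := by
    have h : ∀ sigma : Level n, ∃ r, sigma.1 ≤ tau.1 → r ∈ R ∧
        sigma.1.cells = tau.1.cells.erase (r, tau.1.rowLen r - 1) := by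
      intro sigma
      by_cases hs : sigma.1 ≤ tau.1
      · obtain ⟨r, h1, h2⟩ := exists_erase hs
        refine ⟨r, fun _ => ⟨Finset.mem_filter.2 ⟨Finset.mem_range.2 ?_, h1⟩, h2⟩⟩
        rw [← tau.2]
        exact fst_lt_card tau.1 (c := (r, 0))
          (YoungDiagram.mem_iff_lt_rowLen.2 (Nat.zero_lt_of_lt h1))
      · exact ⟨0, fun h => absurd h hs⟩
    choose f hf using h
    refine Finset.card_le_card_of_injOn f ?_ ?_
    · intro sigma hs
      exact (hf sigma (Finset.mem_filter.1 hs).2).1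
    · intro sigma hs sigma' hs' heq
      refine Subtype.ext (YoungDiagram.ext ?_)
      rw [(hf sigma (Finset.mem_filter.1 hs).2).2, (hf sigma' (Finset.mem_filter.1 hs').2).2, heq]
  let A := insert 0 (R.image Nat.succ)
  have hA : A.card = R.card + 1 := by
    rw [Finset.card_insert_of_notMem (by simp), Finset.card_image_of_injective _
      Nat.succ_injective]
  have hA' : A.card ≤
      (Finset.univ.filter fun lam : Level (n + 1 + 1) => tau.1 ≤ lam.1).card := by
    have h : ∀ i ∈ A, ∃ lam : Level (n + 1 + 1),
        lam.1.cells = insert (i, tau.1.rowLen i) tau.1.cells := by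
      intro i hi
      refine exists_addBox tau fun j hj => ?_
      subst hj
      rcases Finset.mem_insert.1 hi with h | h
      · omega
      · obtain ⟨r, hr, h⟩ := Finset.mem_image.1 h
        obtain rfl : r = j := Nat.succ_injective h
        exact (Finset.mem_filter.1 hr).2
    have hdef : ∃ f : ℕ → Level (n + 1 + 1), ∀ i ∈ A,
        (f i).1.cells = insert (i, tau.1.rowLen i) tau.1.cells := by
      -- `lam0` is a default value outside `A`, needed only to make the choice a total function.
      obtain ⟨lam0, -⟩ := h 0 (Finset.mem_insert_self _ _)
      have h' : ∀ i, ∃ lam : Level (n + 1 + 1), i ∈ A →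
          lam.1.cells = insert (i, tau.1.rowLen i) tau.1.cells := fun i =>
        if hi : i ∈ A then (h i hi).imp fun _ h _ => h else ⟨lam0, fun h => absurd h hi⟩
      choose f hf using h'
      exact ⟨f, hf⟩
    obtain ⟨f, hf⟩ := hdef
    refine Finset.card_le_card_of_injOn f ?_ ?_
    · intro i hi
      refine Finset.mem_coe.2 (Finset.mem_filter.2 ⟨Finset.mem_univ _, ?_⟩)
      rw [← YoungDiagram.cells_subset_iff, hf i hi]
      exact Finset.subset_insert _ _
    · intro i hi j hj hij
      have h1 : (i, tau.1.rowLen i) ∈ insert (j, tau.1.rowLen j) tau.1.cells := by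
        rw [← hf j hj, ← hij, hf i hi]
        exact Finset.mem_insert_self _ _
      rcases Finset.mem_insert.1 h1 with h1 | h1
      · exact (Prod.mk.inj h1).1
      · exact absurd (YoungDiagram.mem_iff_lt_rowLen.1 h1) (lt_irrefl _)
  omega

/-- For distinct diagrams a common lower neighbour must be the intersection, so there is at most
one. If it exists, the union has exactly one box more than either and is a common upper neighbour.
-/
theorem sum_edge_below_le_above {n : ℕ} {tau tau' : Level (n + 1)} (hne : tau ≠ tau') :
    ∑ sigma, edge sigma tau * edge sigma tau' ≤ ∑ lam, edge tau lam * edge tau' lam := by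
  classical
  rw [sum_edge_above, sum_edge_below, Nat.cast_le]
  have hcard : ∀ mu : YoungDiagram, mu.cells.card = mu.card := fun _ => rfl
  have hinf : (tau.1.cells ∩ tau'.1.cells).card < n + 1 := by
    by_contra! hlt
    have h1 := Finset.eq_of_subset_of_card_le
      (Finset.inter_subset_left : tau.1.cells ∩ tau'.1.cells ⊆ _)
      (by rwa [hcard, tau.2])
    have h2 := Finset.eq_of_subset_of_card_le
      (Finset.inter_subset_right : tau.1.cells ∩ tau'.1.cells ⊆ _)
      (by rwa [hcard, tau'.2])
    exact hne (Subtype.ext (YoungDiagram.ext (h1.symm.trans h2)))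
  have hsigma : ∀ sigma : Level n, sigma.1 ≤ tau.1 ∧ sigma.1 ≤ tau'.1 →
      sigma.1.cells = tau.1.cells ∩ tau'.1.cells := by
    intro sigma hs
    refine Finset.eq_of_subset_of_card_le (Finset.subset_inter
      (YoungDiagram.cells_subset_iff.2 hs.1) (YoungDiagram.cells_subset_iff.2 hs.2)) ?_
    rw [hcard, sigma.2]
    omega
  rcases Finset.eq_empty_or_nonempty
    (Finset.univ.filter fun sigma : Level n => sigma.1 ≤ tau.1 ∧ sigma.1 ≤ tau'.1) with h | h
  · rw [h, Finset.card_empty]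
    exact Nat.zero_le _
  · have hle : (Finset.univ.filter fun sigma : Level n =>
        sigma.1 ≤ tau.1 ∧ sigma.1 ≤ tau'.1).card ≤ 1 := by
      refine Finset.card_le_one.2 fun a ha b hb => Subtype.ext (YoungDiagram.ext ?_)
      rw [hsigma a (Finset.mem_filter.1 ha).2, hsigma b (Finset.mem_filter.1 hb).2]
    refine hle.trans (Nat.one_le_iff_ne_zero.2 ?_)
    obtain ⟨sigma, hs⟩ := h
    have hc := hsigma sigma (Finset.mem_filter.1 hs).2
    have hsup : (tau.1 ⊔ tau'.1).card = n + 1 + 1 := by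
      rw [← hcard, YoungDiagram.cells_sup]
      have := Finset.card_union_add_card_inter tau.1.cells tau'.1.cells
      rw [← hc, hcard, hcard, hcard, sigma.2, tau.2, tau'.2] at this
      omega
    exact Finset.card_ne_zero_of_mem (a := ⟨_, hsup⟩)
      (Finset.mem_filter.2 ⟨Finset.mem_univ _, le_sup_left, le_sup_right⟩)

theorem sum_edge_below_add_le_above {n : ℕ} (tau tau' : Level (n + 1)) :
    ∑ sigma, edge sigma tau * edge sigma tau' + (if tau = tau' then 1 else 0) ≤
      ∑ lam, edge tau lam * edge tau' lam := by
  split_ifs with h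
  · subst h
    classical
    rw [sum_edge_above, sum_edge_below, Finset.filter_congr fun _ _ => and_self_iff,
      Finset.filter_congr fun _ _ => and_self_iff]
    exact_mod_cast card_below_lt_card_above tau
  · rw [add_zero]
    exact sum_edge_below_le_above h

/-! ### Restriction and induction of characters -/

theorem factorial_pos_real (n : ℕ) : (0 : ℝ) < n.factorial := Nat.cast_pos.2 n.factorial_pos

/-- The restricted character is a class function, expanded here in irreducible characters by column
orthogonality in `S_n`. -/
theorem chiRe_embedPerm {n : ℕ} (lam : Level (n + 1)) (g : Perm (Fin n)) :
    chiRe lam (embedPerm n g) = ∑ tau, mult tau lam * chiRe tau g := by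
  classical
  have hfac := factorial_pos_real n
  have h1 : ∑ tau, mult tau lam * chiRe tau g =
      ∑ h, chiRe lam (embedPerm n h) / n.factorial * ∑ tau, chiRe tau g * chiRe tau h := by
    simp only [mult, Finset.sum_div, Finset.sum_mul, Finset.mul_sum]
    rw [Finset.sum_comm]
    refine Finset.sum_congr rfl fun h _ => Finset.sum_congr rfl fun tau _ => ?_
    ring
  simp only [sum_chiRe_mul_chiRe_level, mul_ite, mul_zero] at h1
  rw [h1, ← Finset.sum_filter, sum_filter_isConj g
    (f := fun h => chiRe lam (embedPerm n h) / n.factorial * (n.factorial / classSize g))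
    fun h hh => by rw [chiRe_eq_of_isConj lam (isConj_embedPerm_iff.2 hh)]]
  have := classSize_pos g
  field_simp

theorem numFixed_add_sum_cycleType {n : ℕ} (g : Perm (Fin n)) :
    numFixed g + g.cycleType.sum = n := by
  rw [Perm.sum_cycleType, numFixed]
  have h := Finset.card_filter_add_card_filter_not (s := (Finset.univ : Finset (Fin n)))
    (fun i => g i = i)
  rwa [Finset.card_univ, Fintype.card_fin] at h

theorem numFixed_embedPerm {n : ℕ} (g : Perm (Fin n)) :
    numFixed (embedPerm n g) = numFixed g + 1 := by
  have h1 := numFixed_add_sum_cycleType g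
  have h2 := numFixed_add_sum_cycleType (embedPerm n g)
  rw [cycleType_embedPerm] at h2
  omega

theorem numFixed_eq_of_isConj {n : ℕ} {g h : Perm (Fin n)} (hgh : IsConj g h) :
    numFixed g = numFixed h := by
  have h1 := numFixed_add_sum_cycleType g
  have h2 := numFixed_add_sum_cycleType h
  rw [Perm.isConj_iff_cycleType_eq.1 hgh] at h1
  omega

theorem classSize_mul_eq {n : ℕ} (g : Perm (Fin n)) :
    classSize g * ((numFixed g).factorial * (g.cycleType.prod *
      ∏ m ∈ g.cycleType.toFinset, (g.cycleType.count m).factorial : ℕ)) = n.factorial := by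
  have h := Perm.card_isConj_mul_eq g
  have h2 : n - g.cycleType.sum = numFixed g := by
    have := numFixed_add_sum_cycleType g
    omega
  simp only [Fintype.card_fin, h2, mul_assoc] at h
  rw [classSize]
  exact_mod_cast h

/-- In the centralizer orders of `g` and its embedding only the factor `n₁!` differs, because the
nontrivial cycles are the same. -/
theorem classSize_embedPerm {n : ℕ} (g : Perm (Fin n)) :
    numFixed (embedPerm n g) * classSize (embedPerm n g) = (n + 1) * classSize g := by
  have h1 := classSize_mul_eq g
  have h2 := classSize_mul_eq (embedPerm n g)
  rw [cycleType_embedPerm, numFixed_embedPerm, Nat.factorial_succ, Nat.factorial_succ] at h2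
  rw [numFixed_embedPerm]
  generalize (g.cycleType.prod *
      ∏ m ∈ g.cycleType.toFinset, (g.cycleType.count m).factorial : ℕ) = P at h1 h2
  have hP0 : ((numFixed g).factorial * P : ℝ) ≠ 0 := fun h => by
    rw [h, mul_zero] at h1
    exact (factorial_pos_real n).ne h1
  refine mul_right_cancel₀ hP0 ?_
  push_cast at h1 h2 ⊢
  linear_combination h2 - ((n : ℝ) + 1) * h1

/-- By Frobenius reciprocity the left side is the character induced from `S^tau`. Column
orthogonality in `S_{n+1}` leaves the class of `g`, and the ratio of class sizes yields the number
of fixed points. -/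
theorem sum_mult_mul_chiRe {n : ℕ} (tau : Level n) (g : Perm (Fin n)) :
    ∑ lam, mult tau lam * chiRe lam (embedPerm n g) =
      numFixed (embedPerm n g) * chiRe tau g := by
  classical
  have hfac := factorial_pos_real n
  have h1 : ∑ lam, mult tau lam * chiRe lam (embedPerm n g) =
      ∑ h, chiRe tau h / n.factorial *
        ∑ lam, chiRe lam (embedPerm n g) * chiRe lam (embedPerm n h) := by
    simp only [mult, Finset.sum_div, Finset.sum_mul, Finset.mul_sum]
    rw [Finset.sum_comm]
    refine Finset.sum_congr rfl fun h _ => Finset.sum_congr rfl fun tau _ => ?_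
    ring
  simp only [sum_chiRe_mul_chiRe_level, mul_ite, mul_zero, isConj_embedPerm_iff] at h1
  rw [h1, ← Finset.sum_filter, sum_filter_isConj g
    (f := fun h => chiRe tau h / n.factorial * ((n + 1).factorial / classSize (embedPerm n g)))
    fun h hh => by rw [chiRe_eq_of_isConj tau hh]]
  have h2 := classSize_embedPerm g
  have h3 := classSize_pos (embedPerm n g)
  rw [Nat.factorial_succ]
  push_cast
  field_simp
  linear_combination (-chiRe tau g) * h2

/-- An induced character vanishes off the conjugates of the subgroup, and elements of the embedded
`S_n` have a fixed point. -/
theorem sum_mult_mul_chiRe_eq_zero {n : ℕ} (tau : Level n) {g : Perm (Fin (n + 1))}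
    (hg : numFixed g = 0) : ∑ lam, mult tau lam * chiRe lam g = 0 := by
  classical
  have h1 : ∑ lam, mult tau lam * chiRe lam g =
      ∑ h, chiRe tau h / n.factorial * ∑ lam, chiRe lam g * chiRe lam (embedPerm n h) := by
    simp only [mult, Finset.sum_div, Finset.sum_mul, Finset.mul_sum]
    rw [Finset.sum_comm]
    refine Finset.sum_congr rfl fun h _ => Finset.sum_congr rfl fun tau _ => ?_
    ring
  rw [h1]
  refine Finset.sum_eq_zero fun h _ => ?_
  rw [sum_chiRe_mul_chiRe_level, if_neg, mul_zero]
  intro hc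
  have := numFixed_eq_of_isConj hc
  rw [numFixed_embedPerm] at this
  omega

/-! ### The branching rule -/

theorem numFixed_one (n : ℕ) : numFixed (1 : Perm (Fin n)) = n := by
  simp [numFixed]

theorem dim_eq_sum_mult {n : ℕ} (lam : Level (n + 1)) :
    (dim lam : ℝ) = ∑ tau, mult tau lam * dim tau := by
  have h := chiRe_embedPerm lam 1
  rw [map_one] at h
  simpa only [chiRe_one] using h

theorem sum_mult_mul_dim {n : ℕ} (tau : Level n) :
    ∑ lam, mult tau lam * dim lam = (n + 1) * dim tau := by
  have h := sum_mult_mul_chiRe tau 1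
  rw [map_one, numFixed_one] at h
  simpa only [chiRe_one, Nat.cast_add, Nat.cast_one] using h

theorem sum_dim_sq (n : ℕ) : ∑ lam : Level n, (dim lam : ℝ) * dim lam = n.factorial := by
  classical
  have h := sum_chiRe_mul_chiRe_level (1 : Perm (Fin n)) 1
  have h1 : classSize (1 : Perm (Fin n)) = 1 := by
    have h2 := classSize_mul_eq (1 : Perm (Fin n))
    rw [numFixed_one, Perm.cycleType_one] at h2
    have h3 := factorial_pos_real n
    simp only [Multiset.prod_zero, Multiset.toFinset_zero, Finset.prod_empty, Nat.cast_one,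
      mul_one] at h2
    exact (mul_eq_right₀ h3.ne').1 h2
  rw [if_pos (IsConj.refl _), h1, div_one] at h
  simpa only [chiRe_one] using h

theorem sum_mul_self_sum {I J : Type*} [Fintype I] [Fintype J] (e : I → J → ℝ) (d : J → ℝ) :
    ∑ i, (∑ j, e i j * d j) * (∑ j, e i j * d j) =
      ∑ j, ∑ j', (d j * d j') * ∑ i, e i j * e i j' := by
  simp only [Finset.sum_mul_sum]
  simp only [Finset.mul_sum]
  rw [Finset.sum_comm]
  refine Finset.sum_congr rfl fun j _ => ?_
  rw [Finset.sum_comm]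
  refine Finset.sum_congr rfl fun j' _ => Finset.sum_congr rfl fun i _ => ?_
  ring

/-- The branching sum over edges is at most `dim lam` for each `lam`, while the squares of the
dimensions total `(n+1)!`. The hypothesis forces equality in every term, and positivity of `dim tau`
then gives equality of the coefficients. -/
theorem mult_eq_edge_of_factorial_le {n : ℕ}
    (h : ((n + 1).factorial : ℝ) ≤ ∑ lam : Level (n + 1),
      (∑ tau, edge tau lam * dim tau) * (∑ tau, edge tau lam * dim tau))
    (tau : Level n) (lam : Level (n + 1)) : mult tau lam = edge tau lam := by
  have hle : ∀ lam : Level (n + 1), ∀ tau : Level n,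
      edge tau lam * dim tau ≤ mult tau lam * dim tau := fun lam tau =>
    mul_le_mul_of_nonneg_right (edge_le_mult tau lam) (Nat.cast_nonneg _)
  have hle2 : ∀ lam : Level (n + 1), ∑ tau, edge tau lam * dim tau ≤ (dim lam : ℝ) := fun lam =>
    (Finset.sum_le_sum fun tau _ => hle lam tau).trans_eq (dim_eq_sum_mult lam).symm
  have hnonneg : ∀ lam : Level (n + 1), 0 ≤ ∑ tau, edge tau lam * (dim tau : ℝ) := fun lam =>
    Finset.sum_nonneg fun tau _ => mul_nonneg (edge_nonneg tau lam) (Nat.cast_nonneg _)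
  have hle3 : ∀ lam ∈ (Finset.univ : Finset (Level (n + 1))),
      (∑ tau, edge tau lam * dim tau) * (∑ tau, edge tau lam * dim tau) ≤
        (dim lam : ℝ) * dim lam := fun lam _ =>
    mul_self_le_mul_self (hnonneg lam) (hle2 lam)
  have heq := (Finset.sum_eq_sum_iff_of_le hle3).1
    (le_antisymm (Finset.sum_le_sum hle3) (by rwa [sum_dim_sq])) lam (Finset.mem_univ _)
  have heq2 := (mul_self_inj (hnonneg lam) (Nat.cast_nonneg _)).1 heq
  rw [dim_eq_sum_mult] at heq2
  have heq3 := (Finset.sum_eq_sum_iff_of_le fun tau _ => hle lam tau).1 heq2 tau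
    (Finset.mem_univ _)
  exact (mul_right_cancel₀ (Nat.cast_ne_zero.2 (dim_pos tau).ne') heq3).symm

/-- The branching rule, in terms of multiplicities. -/
theorem mult_eq_edge {n : ℕ} (tau : Level n) (lam : Level (n + 1)) :
    mult tau lam = edge tau lam := by
  classical
  induction n with
  | zero =>
    refine mult_eq_edge_of_factorial_le ?_ tau lam
    rw [sum_mul_self_sum]
    have h1 : ∑ tau : Level 0, (dim tau : ℝ) * dim tau = 1 := by simpa using sum_dim_sq 0
    have h2 : ((0 + 1).factorial : ℝ) = 1 := by simp
    rw [h2, ← h1]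
    refine Finset.sum_le_sum fun tau _ => ?_
    -- At the bottom level the diagonal term alone suffices.
    refine le_trans ?_ (Finset.single_le_sum (fun tau' _ => ?_) (Finset.mem_univ tau))
    · exact le_mul_of_one_le_right (by positivity) (one_le_sum_edge_above tau)
    · exact mul_nonneg (by positivity)
        (Finset.sum_nonneg fun lam _ => mul_nonneg (edge_nonneg _ _) (edge_nonneg _ _))
  | succ n ih =>
    refine mult_eq_edge_of_factorial_le ?_ tau lam
    -- By `ih` edges are multiplicities one level lower, so this is the dimension of an induced
    -- representation.
    have h1 : ∀ sigma : Level n, ∑ tau, edge sigma tau * dim tau = (n + 1) * (dim sigma : ℝ) :=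
      fun sigma => by rw [← sum_mult_mul_dim]; simp only [ih]
    -- The value arises as `(n+1)² n! + (n+1)! = (n+2)!`, the second summand coming from the
    -- diagonal.
    have h2 : ∑ tau : Level (n + 1), ∑ tau' : Level (n + 1), ((dim tau : ℝ) * dim tau') *
        (∑ sigma, edge sigma tau * edge sigma tau' + (if tau = tau' then 1 else 0)) =
          ((n + 1 + 1).factorial : ℝ) := by
      simp only [mul_add, Finset.sum_add_distrib, mul_ite, mul_one, mul_zero,
        Finset.sum_ite_eq, Finset.mem_univ, if_true]
      rw [← sum_mul_self_sum (fun (sigma : Level n) tau => edge sigma tau), sum_dim_sq]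
      simp only [h1]
      rw [Finset.sum_congr rfl fun sigma _ => mul_mul_mul_comm ((n : ℝ) + 1) (dim sigma : ℝ) _ _,
        ← Finset.mul_sum, sum_dim_sq, Nat.factorial_succ (n + 1), Nat.factorial_succ]
      push_cast
      ring
    rw [← h2, sum_mul_self_sum]
    exact Finset.sum_le_sum fun tau _ => Finset.sum_le_sum fun tau' _ =>
      mul_le_mul_of_nonneg_left (sum_edge_below_add_le_above tau tau') (by positivity)

/-! ### The down-up chain -/

/-- The normalized character `χ^lam(g) / dim lam`. -/
noncomputable def normChi {n : ℕ} (g : Perm (Fin n)) (lam : Level n) : ℝ :=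
  chiRe lam g / dim lam

theorem dim_ne_zero {n : ℕ} (lam : Level n) : (dim lam : ℝ) ≠ 0 :=
  Nat.cast_ne_zero.2 (dim_pos lam).ne'

theorem upStep_apply {n : ℕ} (tau : Level n) (lam : Level (n + 1)) :
    upStep n tau lam = edge tau lam * dim lam / ((n + 1) * dim tau) := by
  have h1 := dim_ne_zero tau
  have h2 := dim_ne_zero lam
  have h3 := (factorial_pos_real n).ne'
  have h4 : (n : ℝ) + 1 ≠ 0 := Nat.cast_add_one_ne_zero n
  rw [upStep, Matrix.of_apply, plancherel, plancherel, Nat.factorial_succ]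
  push_cast
  field_simp

theorem upStep_mulVec_normChi {n : ℕ} (g : Perm (Fin (n + 1))) (tau : Level n) :
    (upStep n).mulVec (normChi g) tau =
      (∑ lam, mult tau lam * chiRe lam g) / ((n + 1) * dim tau) := by
  rw [Matrix.mulVec, dotProduct, Finset.sum_div]
  refine Finset.sum_congr rfl fun lam _ => ?_
  have h2 := dim_ne_zero lam
  rw [upStep_apply, mult_eq_edge, normChi]
  field_simp

theorem upStep_mulVec_normChi_embedPerm {n : ℕ} (g : Perm (Fin n)) :
    (upStep n).mulVec (normChi (embedPerm n g)) =
      ((numFixed (embedPerm n g) : ℝ) / (n + 1)) • normChi g := by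
  ext tau
  rw [upStep_mulVec_normChi, sum_mult_mul_chiRe, Pi.smul_apply, smul_eq_mul, normChi,
    div_mul_div_comm]

theorem upStep_mulVec_normChi_of_numFixed_eq_zero {n : ℕ} {g : Perm (Fin (n + 1))}
    (hg : numFixed g = 0) : (upStep n).mulVec (normChi g) = 0 := by
  ext tau
  rw [upStep_mulVec_normChi, sum_mult_mul_chiRe_eq_zero tau hg, zero_div, Pi.zero_apply]

theorem downStep_mulVec_normChi {n : ℕ} (g : Perm (Fin n)) :
    (downStep n).mulVec (normChi g) = normChi (embedPerm n g) := by
  ext lam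
  rw [Matrix.mulVec, dotProduct, normChi, chiRe_embedPerm, Finset.sum_div]
  refine Finset.sum_congr rfl fun tau _ => ?_
  have h1 := dim_ne_zero tau
  rw [downStep, Matrix.of_apply, mult_eq_edge, normChi]
  field_simp

theorem exists_isConj_embedPerm {n : ℕ} {g : Perm (Fin (n + 1))} (hg : numFixed g ≠ 0) :
    ∃ h, IsConj g (embedPerm n h) := by
  obtain ⟨i, hi⟩ := Finset.card_ne_zero.1 hg
  have hi' : g i = i := (Finset.mem_filter.1 hi).2
  obtain ⟨h, hh⟩ := exists_embedPerm_eq (g := swap i (Fin.last n) * g * (swap i (Fin.last n))⁻¹)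
    (by rw [swap_inv, Perm.mul_apply, Perm.mul_apply, swap_apply_right, hi', swap_apply_left])
  exact ⟨h, hh ▸ isConj_iff.2 ⟨swap i (Fin.last n), rfl⟩⟩

theorem normChi_eq_of_isConj {n : ℕ} {g h : Perm (Fin n)} (hgh : IsConj g h) :
    normChi g = normChi h := by
  ext lam
  rw [normChi, normChi, chiRe_eq_of_isConj lam hgh]

/-- The outer steps of the chain contribute `n₁/(n+1)`, and the inner chain acts on a permutation
with one fixed point and one letter fewer; this matches the recursion of the falling factorials. -/
theorem chainJ_mulVec_normChi {n k : ℕ} (hkn : k ≤ n) (g : Perm (Fin n)) :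
    (chainJ n k).mulVec (normChi g) =
      (((numFixed g).descFactorial k : ℝ) / (n.descFactorial k : ℝ)) • normChi g := by
  induction k generalizing n with
  | zero => simp [chainJ]
  | succ k ih =>
    obtain ⟨n, rfl⟩ : ∃ m, n = m + 1 := ⟨n - 1, by omega⟩
    rw [chainJ, ← Matrix.mulVec_mulVec, ← Matrix.mulVec_mulVec]
    by_cases hg : numFixed g = 0
    -- Without fixed points the up step already gives `0`, in agreement with the vanishing falling
    -- factorial of `0` of positive length `k + 1`.
    · rw [upStep_mulVec_normChi_of_numFixed_eq_zero hg, Matrix.mulVec_zero, Matrix.mulVec_zero,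
        hg, Nat.zero_descFactorial_succ, Nat.cast_zero, zero_div, zero_smul]
    · obtain ⟨h, hh⟩ := exists_isConj_embedPerm hg
      rw [normChi_eq_of_isConj hh, numFixed_eq_of_isConj hh, upStep_mulVec_normChi_embedPerm,
        Matrix.mulVec_smul, ih (by omega), Matrix.mulVec_smul, Matrix.mulVec_smul,
        downStep_mulVec_normChi, smul_smul, numFixed_embedPerm, Nat.succ_descFactorial_succ,
        Nat.succ_descFactorial_succ, div_mul_div_comm]
      push_cast
      rfl

/-! ### The orthonormal basis -/

/-- The function `ψ_C`. -/
noncomputable def psi {n : ℕ} (C : ConjClasses (Perm (Fin n))) (lam : Level n) : ℝ :=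
  charTable n lam C * Real.sqrt n.factorial / dim lam

theorem psi_mk {n : ℕ} (g : Perm (Fin n)) :
    psi (ConjClasses.mk g) = Real.sqrt (classSize g) • normChi g := by
  ext lam
  have h := Real.sqrt_pos.2 (factorial_pos_real n)
  rw [psi, charTable_mk, Pi.smul_apply, normChi, smul_eq_mul]
  field_simp

open Classical in
theorem plancherelInner_psi {n : ℕ} (C C' : ConjClasses (Perm (Fin n))) :
    plancherelInner (psi C) (psi C') = if C = C' then 1 else 0 := by
  rw [← Matrix.one_apply, ← transpose_mul_charTable, Matrix.mul_apply, plancherelInner]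
  refine Finset.sum_congr rfl fun lam _ => ?_
  have h1 := dim_ne_zero lam
  have h2 := (factorial_pos_real n).ne'
  have h3 := Real.mul_self_sqrt (factorial_pos_real n).le
  rw [Matrix.transpose_apply, psi, psi, plancherel, div_mul_div_comm, mul_mul_mul_comm, h3]
  field_simp

theorem linearIndependent_psi (n : ℕ) :
    LinearIndependent ℝ (psi : ConjClasses (Perm (Fin n)) → Level n → ℝ) := by
  classical
  rw [Fintype.linearIndependent_iff]
  intro c hc C
  -- Pairing a linear relation with `psi C` isolates the coefficient at `C`.
  have h : plancherelInner (∑ C', c C' • psi C') (psi C) = c C := by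
    have h1 : plancherelInner (∑ C', c C' • psi C') (psi C) =
        ∑ C', c C' * plancherelInner (psi C') (psi C) := by
      simp only [plancherelInner, Finset.sum_apply, Pi.smul_apply, smul_eq_mul, Finset.sum_mul,
        Finset.mul_sum]
      rw [Finset.sum_comm]
      simp only [mul_assoc]
    simp [h1, plancherelInner_psi]
  rw [← h, hc]
  simp [plancherelInner]

end YoungLattice

open YoungLattice in
theorem mainTheorem7 (n k : ℕ) (hk : 1 ≤ k) (hkn : k ≤ n) :
    ∃ ψ : Module.Basis (ConjClasses (Equiv.Perm (Fin n))) ℝ (Level n → ℝ),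
      (∀ (g : Equiv.Perm (Fin n)) (lam : Level n),
        ((ψ (ConjClasses.mk g) lam : ℝ) : ℂ) =
          (Real.sqrt (Nat.card (ConjClasses.mk g).carrier : ℝ) : ℂ) * chi lam g / (dim lam : ℂ)) ∧
      (∀ C : ConjClasses (Equiv.Perm (Fin n)), plancherelInner (ψ C) (ψ C) = 1) ∧
      (∀ C C' : ConjClasses (Equiv.Perm (Fin n)), C ≠ C' → plancherelInner (ψ C) (ψ C') = 0) ∧
      (∀ g : Equiv.Perm (Fin n),
        (chainJ n k).mulVec (ψ (ConjClasses.mk g)) =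
          (((numFixed g).descFactorial k : ℝ) / (n.descFactorial k : ℝ)) •
            ψ (ConjClasses.mk g)) := by
  classical
  have : Nonempty (ConjClasses (Equiv.Perm (Fin n))) := ⟨ConjClasses.mk 1⟩
  have hcard : Fintype.card (ConjClasses (Equiv.Perm (Fin n))) =
      Module.finrank ℝ (Level n → ℝ) := by
    rw [Module.finrank_fintype_fun_eq_card, card_level_eq_card_conjClasses]
  have hψ : ∀ C, basisOfLinearIndependentOfCardEqFinrank (linearIndependent_psi n) hcard C =
      psi C := fun C => congrFun (coe_basisOfLinearIndependentOfCardEqFinrank _ _) C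
  refine ⟨basisOfLinearIndependentOfCardEqFinrank (linearIndependent_psi n) hcard,
    fun g lam => ?_, fun C => ?_, fun C C' h => ?_, fun g => ?_⟩
  · rw [hψ, psi_mk, Pi.smul_apply, smul_eq_mul, normChi, ← mul_div_assoc, Complex.ofReal_div,
      Complex.ofReal_mul, ofReal_chiRe, Complex.ofReal_natCast]
    rfl
  · rw [hψ, plancherelInner_psi, if_pos rfl]
  · rw [hψ, hψ, plancherelInner_psi, if_neg h]
  · rw [hψ, psi_mk, Matrix.mulVec_smul, chainJ_mulVec_normChi hkn, smul_comm]
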